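/- Let $G$ be a real, connected, compact Lie group with semisimple Lie algebra $\mathfrak g=T_eG$, and let $\mathcal X$ be a linear vector field on $G$, that is, a smooth vector field whose flow $(\varphi_t)_{t\in\mathbb R}$ consists of Lie group automorphisms of $G$. Let $\mathcal D:\mathfrak g\to\mathfrak g$, $\mathcal D(Y)=-[\mathcal X,Y]$ (where $Y \in \mathfrak g$ is identified with the left invariant vector field it determines) be the associated derivation. Then there is a right invariant vector field $X$ on $G$ with $\mathcal X = X + I_*X$, where $I_*$ is the differential of the inversion $g\mapsto g^{-1}$. Moreover, for every such $X$ (identified with its value in $T_eG$), the following are equivalent: 1. for every $g\in G$ the orbit $t\mapsto \exp(tX)\,g$ of the invariant flow is periodic; 2. $e$ is a periodic point of the invariant flow, i.e. $t\mapsto\exp(tX)\,e$ is periodic; 3. every $g\in G$ is a periodic point of the linear flow, i.e. $t\mapsto\varphi_t(g)$ is periodic; 4. for every $g\in G$, $\mathrm{Ad}(g)$ is a periodic point of the flow $e^{t\mathcal D}$, i.e. $t\mapsto e^{t\mathcal D}\circ \mathrm{Ad}(g)$ is periodic. Here a curve $\gamma:\mathbb R\to M$ is called periodic if there is $s>0$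 with $\gamma(t+s)=\gamma(t)$ for all $t\in\mathbb R$; constant curves are periodic, and in 1, 3 and 4 the period may depend on $g$. -/

import Mathlib

open scoped Manifold ContDiff

noncomputable section

namespace LinearFlow

section Curves

/-- A curve `γ : ℝ → α` is periodic: for some `s > 0`, `γ (t + s) = γ t` for all `t`.
Constant curves are periodic. -/
def IsPeriodicCurve {α : Type*} (γ : ℝ → α) : Prop :=
  ∃ s : ℝ, 0 < s ∧ ∀ t : ℝ, γ (t + s) = γ t

end Curves

section Operators

variable {E : Type*} [NormedAddCommGroup E] [NormedSpace ℝ E] [FiniteDimensional ℝ E]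

/-- The operator `e ^ (t A)`, for an endomorphism `A` of a finite-dimensional real vector space. -/
def operatorExpFlow (A : E →ₗ[ℝ] E) (t : ℝ) : E →L[ℝ] E :=
  NormedSpace.exp (t • LinearMap.toContinuousLinearMap A)

end Operators

section LieGroups

variable {E : Type*} [NormedAddCommGroup E] [NormedSpace ℝ E] {H : Type*} [TopologicalSpace H]
  (I : ModelWithCorners ℝ E H) {G : Type*} [TopologicalSpace G] [ChartedSpace H G]

/-- `φ` is the (global) flow of the vector field `V`: for every `g`, the curve `t ↦ φ t g` is an
integral curve of `V` that starts at `g`. -/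
def IsFlowOf (φ : ℝ → G → G) (V : ∀ g : G, TangentSpace I g) : Prop :=
  ∀ g : G, φ 0 g = g ∧ IsMIntegralCurve (I := I) (fun t ↦ φ t g) V

/-- The vector field `V` is smooth, as a section of the tangent bundle. -/
def IsSmoothField [IsManifold I 1 G] (V : ∀ g : G, TangentSpace I g) : Prop :=
  ContMDiff I I.tangent ∞ (fun g ↦ (⟨g, V g⟩ : TangentBundle I G))

variable [Group G]

/-- `f : G → G` is an automorphism of the Lie group `G`: a group automorphism that is smooth
together with its inverse. -/
def IsLieGroupAutomorphism (f : G → G) : Prop :=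
  ∃ e : G ≃* G, (∀ g, e g = f g) ∧ ContMDiff I I ∞ e ∧ ContMDiff I I ∞ e.symm

/-- A linear vector field on a Lie group: a smooth vector field that has a global flow consisting
of automorphisms of the Lie group. -/
def IsLinearVectorField [IsManifold I 1 G] (V : ∀ g : G, TangentSpace I g) : Prop :=
  IsSmoothField I V ∧ ∃ φ : ℝ → G → G, IsFlowOf I φ V ∧ ∀ t, IsLieGroupAutomorphism I (φ t)

variable {I}

/-- The right invariant vector field with value `X` at the identity: `g ↦ d(R_g)_e X`, where
`R_g x = x * g`. -/
def rightInvariantField (X : GroupLieAlgebra I G) (g : G) : TangentSpace I g :=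
  mfderiv I I (fun x : G ↦ x * g) (1 : G) X

/-- The vector field `I_* V`, the image of `V` under the differential of the inversion
`x ↦ x⁻¹`: its value at `g` is the image of `V (g⁻¹)` under the differential at `g⁻¹`. -/
def invPushforward (V : ∀ g : G, TangentSpace I g) (g : G) : TangentSpace I g :=
  mfderiv I I (fun x : G ↦ x⁻¹) g⁻¹ (V g⁻¹)

open Classical in
/-- The exponential map of a Lie group: `exp X` is the value at time `1` of the integral curve
through the identity of the invariant vector field determined by `X`. (This curve exists and is
unique on every Lie group; the alternative value `1` is never used there.) -/
def lieExp (X : GroupLieAlgebra I G) : G :=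
  if h : ∃ γ : ℝ → G, γ 0 = 1 ∧ IsMIntegralCurve (I := I) γ (rightInvariantField X)
  then h.choose 1 else 1

/-- The adjoint representation: `Ad g` is the differential at the identity of the conjugation
`x ↦ g * x * g⁻¹`. -/
def Ad (g : G) : GroupLieAlgebra I G →L[ℝ] GroupLieAlgebra I G :=
  mfderiv I I (fun x : G ↦ g * x * g⁻¹) (1 : G)

instance instLieGroupMinSmoothness [LieGroup I ∞ G] : LieGroup I (minSmoothness ℝ 3) G :=
  LieGroup.of_le (n := ∞) (by
    rw [minSmoothness_of_isRCLikeNormedField]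
    exact ENat.LEInfty.out)

instance instIsManifoldOne [LieGroup I ∞ G] : IsManifold I 1 G :=
  IsManifold.of_le (n := ∞) ENat.LEInfty.out

variable [CompleteSpace E] [LieGroup I ∞ G]

/-- The endomorphism `D` of the Lie algebra given by `D Y = -[V, Y]`, where `Y` is identified with
the left invariant vector field that it determines. -/
def derivationOf (V : ∀ g : G, TangentSpace I g) :
    GroupLieAlgebra I G →ₗ[ℝ] GroupLieAlgebra I G where
  toFun Y := - VectorField.mlieBracket I V (mulInvariantVectorField Y) (1 : G)
  map_add' Y Z := by
    rw [mulInvariantVectorField_add, VectorField.mlieBracket_add_right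
      (mdifferentiableAt_mulInvariantVectorField _) (mdifferentiableAt_mulInvariantVectorField _),
      neg_add]
  map_smul' c Y := by
    rw [mulInvariantVectorField_smul, VectorField.mlieBracket_const_smul_right
      (mdifferentiableAt_mulInvariantVectorField _), smul_neg, RingHom.id_apply]

/-- The linear flow `e ^ (t D)` on the Lie algebra, which as a vector space is the model space `E`
(a tangent space is by definition a copy of `E`). -/
def expFlow [FiniteDimensional ℝ E] (D : GroupLieAlgebra I G →ₗ[ℝ] GroupLieAlgebra I G) (t : ℝ) :
    GroupLieAlgebra I G →L[ℝ] GroupLieAlgebra I G :=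
  operatorExpFlow (E := E) D t

end LieGroups

end LinearFlow

end

namespace LinearFlow

open Set Filter Topology MeasureTheory

/-! Existence of $X$: translating $\mathcal X$ to the identity by right multiplications gives a
continuous map $c : G \to \mathfrak g$. Since the flow acts by automorphisms, $c(gh) = c(g) +
\mathrm{Ad}(g)c(h)$. Averaging over Haar measure makes this cocycle a coboundary, $c(g) = X -
\mathrm{Ad}(g)X$, and translating back gives $\mathcal X = X + I_*X$.

Equivalences: put $\gamma(t) = \exp(tX)$. The field $X + I_*X$ generates conjugation, so
$\varphi_t(g) = \gamma(t) g \gamma(t)^{-1}$. The derivative of $\mathrm{Ad}$ at $e$ is the bracket,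
and it identifies $\mathcal D$ with $\mathrm{ad}\,X$, so $e^{t\mathcal D} = \mathrm{Ad}(\gamma(t))$.
Semisimplicity enters only through the trivial centre of $\mathfrak g$. Then $\mathrm{Ad}$ is
injective near $e$, its kernel is discrete in a compact group, hence finite, and
$\mathrm{Ad}(\gamma(s)) = 1$ makes $\gamma(s)$ an element of finite order. This gives 4 → 2.

The hard step is 3 → 4, because the period depends on $g$. Outside a countable set of times $s$,
commuting with $e^{s\,\mathrm{ad} X}$ forces commuting with $\mathrm{ad}\,X$
(`exists_countable_commute_exp`). So $G$ is covered by countably many closed subgroups: the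
centralizers of $\gamma(s)$ for exceptional $s$, and the centralizer of $\mathrm{ad}\,X$. By Baire
and connectedness one of them is $G$; either $\gamma(s)$ is central or $X = 0$. -/

/-! ### Calculus in normed spaces -/

/-- Symmetry of the second derivative. Applied to group operations in a chart, one order of
differentiation gives the derivative of $\mathrm{Ad}$ and the other the derivative of a vector
field. -/
theorem exists_mixed_derivative {E F : Type*} [NormedAddCommGroup E] [NormedSpace ℝ E]
    [NormedAddCommGroup F] [NormedSpace ℝ F] {f : E × E → F} {u₀ v₀ : E}
    (hf : ContDiffAt ℝ ∞ f (u₀, v₀)) :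
    ∃ B : E →L[ℝ] E →L[ℝ] F,
      HasStrictFDerivAt (fun u ↦ fderiv ℝ (fun v ↦ f (u, v)) v₀) B u₀ ∧
      ∀ Z : E, HasFDerivAt (fun v ↦ fderiv ℝ (fun u ↦ f (u, v)) u₀ Z) (B Z) v₀ := by
  have hd : ContDiffAt ℝ 1 (fderiv ℝ f) (u₀, v₀) := hf.fderiv_right (m := 1) (by
    rw [one_add_one_eq_two]; exact ENat.LEInfty.out)
  have hs := hd.hasStrictFDerivAt one_ne_zero
  have hsymm : IsSymmSndFDerivAt ℝ f (u₀, v₀) := hf.isSymmSndFDerivAt (by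
    rw [minSmoothness_of_isRCLikeNormedField]; exact ENat.LEInfty.out)
  have hev : ∀ᶠ p in 𝓝 (u₀, v₀), DifferentiableAt ℝ f p := by
    filter_upwards [(hf.of_le (m := 1) ENat.LEInfty.out).eventually (by simp)] with p hp
    exact hp.differentiableAt one_ne_zero
  have e₂ : ∀ᶠ u in 𝓝 u₀, fderiv ℝ (fun v ↦ f (u, v)) v₀ =
      (fderiv ℝ f (u, v₀)).comp (ContinuousLinearMap.inr ℝ E E) := by
    have hc : ContinuousAt (fun u : E ↦ (u, v₀)) u₀ := by fun_prop
    filter_upwards [hc.eventually hev] with u hu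
    exact (hu.hasFDerivAt.comp v₀ (hasFDerivAt_prodMk_right u v₀)).fderiv
  have e₁ : ∀ᶠ v in 𝓝 v₀, fderiv ℝ (fun u ↦ f (u, v)) u₀ =
      (fderiv ℝ f (u₀, v)).comp (ContinuousLinearMap.inl ℝ E E) := by
    have hc : ContinuousAt (fun v : E ↦ (u₀, v)) v₀ := by fun_prop
    filter_upwards [hc.eventually hev] with v hv
    exact (hv.hasFDerivAt.comp u₀ (hasFDerivAt_prodMk_left u₀ v)).fderiv
  let R : (E × E →L[ℝ] F) →L[ℝ] (E →L[ℝ] F) :=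
    (ContinuousLinearMap.compL ℝ E (E × E) F).flip (ContinuousLinearMap.inr ℝ E E)
  refine ⟨R.comp ((fderiv ℝ (fderiv ℝ f) (u₀, v₀)).comp (ContinuousLinearMap.inl ℝ E E)),
    ?_, fun Z ↦ ?_⟩
  · have h1 : HasStrictFDerivAt (fun u : E ↦ (u, v₀)) (ContinuousLinearMap.inl ℝ E E) u₀ :=
      (hasStrictFDerivAt_id u₀).prodMk (hasStrictFDerivAt_const v₀ u₀)
    have h2 := R.hasStrictFDerivAt.comp u₀
      (HasStrictFDerivAt.comp (g := fderiv ℝ f) u₀ hs h1)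
    refine h2.congr_of_eventuallyEq ?_
    filter_upwards [e₂] with u hu
    rw [hu]; rfl
  · have h2 := (HasFDerivAt.comp (g := fderiv ℝ f) v₀ hs.hasFDerivAt
      (hasFDerivAt_prodMk_right u₀ v₀)).clm_apply (hasFDerivAt_const ((Z, 0) : E × E) v₀)
    have h3 : HasFDerivAt (fun v ↦ fderiv ℝ (fun u ↦ f (u, v)) u₀ Z) _ v₀ :=
      h2.congr_of_eventuallyEq (by filter_upwards [e₁] with v hv; rw [hv]; rfl)
    convert h3 using 1
    ext Y
    simpa [R] using hsymm (Z, 0) (0, Y)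

/-- Composing with a linear left inverse of `f'` gives a map with derivative the identity, to which
the inverse function theorem applies. -/
theorem exists_injOn_nhds_of_injective {E F : Type*} [NormedAddCommGroup E] [NormedSpace ℝ E]
    [CompleteSpace E] [FiniteDimensional ℝ E] [NormedAddCommGroup F] [NormedSpace ℝ F]
    [FiniteDimensional ℝ F] {f : E → F} {f' : E →L[ℝ] F} {u : E}
    (hf : HasStrictFDerivAt f f' u) (hinj : Function.Injective f') :
    ∃ s ∈ 𝓝 u, InjOn f s := by
  obtain ⟨g, hg⟩ := (f' : E →ₗ[ℝ] F).exists_leftInverse_of_injective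
    (LinearMap.ker_eq_bot.2 hinj)
  have h1 := (LinearMap.toContinuousLinearMap g).hasStrictFDerivAt.comp u hf
  have h2 : (LinearMap.toContinuousLinearMap g).comp f' =
      ((ContinuousLinearEquiv.refl ℝ E : E ≃L[ℝ] E) : E →L[ℝ] E) := by
    ext x
    exact LinearMap.congr_fun hg x
  rw [h2] at h1
  let e := h1.toOpenPartialHomeomorph _
  refine ⟨e.source, e.open_source.mem_nhds h1.mem_toOpenPartialHomeomorph_source, ?_⟩
  intro x hx y hy hxy
  refine e.injOn hx hy ?_
  exact congrArg g hxy

/-- The homomorphism law spreads the derivative at 0 to $a' = a d$ everywhere, so $a(t)e^{-td}$ is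
constant. -/
theorem eq_exp_of_hasDerivAt {A : Type*} [NormedRing A] [NormedAlgebra ℝ A] [CompleteSpace A]
    {a : ℝ → A} {d : A} (h0 : a 0 = 1) (hadd : ∀ s t, a (s + t) = a s * a t)
    (hd : HasDerivAt a d 0) (t : ℝ) : a t = NormedSpace.exp (t • d) := by
  have ha : ∀ t, HasDerivAt a (a t * d) t := by
    intro t
    have h1 : HasDerivAt (fun x ↦ a t * a (x - t)) (a t * d) t := by
      have h2 : HasDerivAt (fun x ↦ a (x - t)) d t := by
        have := HasDerivAt.comp_sub_const t t (f := a) (f' := d) (by simpa using hd)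
        exact this
      exact h2.const_mul (a t)
    convert h1 using 1
    ext x
    rw [← hadd]; congr 1; ring
  have hb : ∀ t, HasDerivAt (fun x ↦ a x * NormedSpace.exp (x • (-d))) 0 t := by
    intro t
    have := (ha t).mul (hasDerivAt_exp_smul_const' (𝕂 := ℝ) (-d) t)
    convert this using 1
    · rfl
    rw [mul_assoc, neg_mul, mul_neg, add_neg_cancel]
  have hc := is_const_of_deriv_eq_zero (fun t ↦ (hb t).differentiableAt)
    (fun t ↦ (hb t).deriv) t 0
  simp only [h0, zero_smul, NormedSpace.exp_zero, mul_one] at hc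
  have hinv : NormedSpace.exp (t • (-d)) * NormedSpace.exp (t • d) = 1 := by
    let : NormedAlgebra ℚ A := NormedAlgebra.restrictScalars ℚ ℝ A
    rw [smul_neg, ← NormedSpace.exp_add_of_commute (Commute.refl (t • d)).neg_left,
      neg_add_cancel, NormedSpace.exp_zero]
  calc a t = a t * (NormedSpace.exp (t • (-d)) * NormedSpace.exp (t • d)) := by
        rw [hinv, mul_one]
    _ = _ := by rw [← mul_assoc, hc, one_mul]

/-! ### Exceptional periods of linear flows -/

/-- A nonconstant periodic orbit forces $e^{\mu s} = 1$ for some nonzero complex root $\mu$ of the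
minimal polynomial of `δ`, and for each of the finitely many $\mu$ only countably many real $s$
satisfy this. -/
theorem exists_countable_periods {V : Type*} [NormedAddCommGroup V] [NormedSpace ℝ V]
    [FiniteDimensional ℝ V] (Φ : ℝ → V →ₗ[ℝ] V) (δ : V →ₗ[ℝ] V)
    (h0 : ∀ v, Φ 0 v = v) (hadd : ∀ s t v, Φ (s + t) v = Φ s (Φ t v))
    (hcomm : ∀ t v, Φ t (δ v) = δ (Φ t v))
    (hd : ∀ v t, HasDerivAt (fun t ↦ Φ t v) (Φ t (δ v)) t) :
    ∃ S : Set ℝ, S.Countable ∧ ∀ s ∉ S, ∀ v, Φ s v = v → δ v = 0 := by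
  let P : Polynomial ℂ := (minpoly ℝ δ).map (algebraMap ℝ ℂ)
  have hP : P ≠ 0 := (Polynomial.map_ne_zero_iff (algebraMap ℝ ℂ).injective).2
    (minpoly.ne_zero (Algebra.IsIntegral.isIntegral δ))
  refine ⟨{0} ∪ ⋃ μ ∈ {μ : ℂ | P.IsRoot μ}, ⋃ n : ℤ,
    {s : ℝ | μ ≠ 0 ∧ μ * s = n * (2 * Real.pi * Complex.I)}, ?_, ?_⟩
  · refine (countable_singleton 0).union
      ((Polynomial.finite_setOfPred_isRoot hP).countable.biUnion fun μ _ ↦ countable_iUnion fun n ↦ ?_)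
    refine Set.Subsingleton.countable ?_
    rintro s ⟨hμ, hs⟩ t ⟨-, ht⟩
    exact_mod_cast mul_left_cancel₀ hμ (hs.trans ht.symm)
  intro s hs v hv
  by_contra hδ
  let K : Submodule ℝ V := LinearMap.ker (Φ s - 1)
  have hK : ∀ w, w ∈ K ↔ Φ s w = w := fun w ↦ by
    simp [K, LinearMap.mem_ker, sub_eq_zero]
  have hKΦ : ∀ t, ∀ w ∈ K, Φ t w ∈ K := fun t w hw ↦ by
    rw [hK] at hw ⊢
    rw [← hadd, add_comm, hadd, hw]
  have hKδ : ∀ w ∈ K, δ w ∈ K := fun w hw ↦ by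
    rw [hK] at hw ⊢
    rw [hcomm, hw]
  -- Passing from the fixed space `K` to its image under `δ` is what later excludes the eigenvalue
  -- 0.
  let K' : Submodule ℝ V := K.map δ
  have hK'K : K' ≤ K := by rintro _ ⟨w, hw, rfl⟩; exact hKδ w hw
  have hK'Φ : ∀ t, ∀ w ∈ K', Φ t w ∈ K' := by
    rintro t _ ⟨w, hw, rfl⟩
    exact ⟨Φ t w, hKΦ t w hw, (hcomm t w).symm⟩
  have hK'δ : ∀ w ∈ K', δ w ∈ K' := fun w hw ↦ ⟨w, hK'K hw, rfl⟩
  let δ' : K' →ₗ[ℝ] K' := δ.restrict hK'δ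
  have hvK' : δ v ∈ K' := ⟨v, (hK v).2 hv, rfl⟩
  -- Complex-valued real-linear functionals form a complex space, so the transpose of `δ` has an
  -- eigenvector there and `V` need not be complexified.
  obtain ⟨ℓ, μ, hℓ0, hℓ⟩ : ∃ (ℓ : V →ₗ[ℝ] ℂ) (μ : ℂ), (∃ w ∈ K', ℓ w ≠ 0) ∧
      ∀ w ∈ K', ℓ (δ w) = μ * ℓ w := by
    let T : (K' →ₗ[ℝ] ℂ) →ₗ[ℂ] (K' →ₗ[ℝ] ℂ) :=
      { toFun := fun ℓ ↦ ℓ ∘ₗ δ'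
        map_add' := fun _ _ ↦ rfl
        map_smul' := fun _ _ ↦ rfl }
    have : Nontrivial K' := ⟨⟨⟨δ v, hvK'⟩, 0, fun h ↦ hδ (congrArg Subtype.val h)⟩⟩
    have : Nontrivial (K' →ₗ[ℝ] ℂ) := inferInstance
    have : FiniteDimensional ℂ (K' →ₗ[ℝ] ℂ) := inferInstance
    obtain ⟨μ, hμ⟩ := Module.End.exists_eigenvalue T
    obtain ⟨ℓ, hℓ⟩ := hμ.exists_hasEigenvector
    obtain ⟨ℓ', hℓ'⟩ := ℓ.exists_extend
    have key : ∀ w : K', ℓ' w = ℓ w := fun w ↦ LinearMap.congr_fun hℓ' w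
    refine ⟨ℓ', μ, ?_, fun w hw ↦ ?_⟩
    · by_contra! hcon
      refine hℓ.2 (LinearMap.ext fun w ↦ ?_)
      rw [← key]; exact hcon w w.2
    · rw [key ⟨w, hw⟩]
      have := LinearMap.congr_fun hℓ.apply_eq_smul ⟨w, hw⟩
      exact (key ⟨δ w, hK'δ w hw⟩).trans this
  obtain ⟨w, hw, hℓw⟩ := hℓ0
  -- By linearity and induction on degree, $\ell(p(\delta)x) = p(\mu)\ell(x)$ on `K'`; take $p$ the
  -- minimal polynomial.
  have hroot : P.IsRoot μ := by
    have h1 : ∀ (p : Polynomial ℝ), ∀ x ∈ K', Polynomial.aeval δ p x ∈ K' ∧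
        ℓ (Polynomial.aeval δ p x) = Polynomial.aeval μ p * ℓ x := by
      intro p
      induction p using Polynomial.induction_on' with
      | add p q hp hq =>
        intro x hx
        simp only [map_add, LinearMap.add_apply, add_mul]
        exact ⟨K'.add_mem (hp x hx).1 (hq x hx).1, by rw [(hp x hx).2, (hq x hx).2]⟩
      | monomial n r =>
        induction n with
        | zero =>
          intro x hx
          simp only [Polynomial.monomial_zero_left, Polynomial.aeval_C,
            Module.algebraMap_end_apply, map_smul]
          exact ⟨K'.smul_mem r hx, by simp⟩
        | succ n ih =>
          intro x hx
          have h2 := ih (δ x) (hK'δ x hx)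
          rw [← Polynomial.monomial_mul_X]
          simp only [map_mul, Polynomial.aeval_X, Module.End.mul_apply]
          exact ⟨h2.1, by rw [h2.2, hℓ x hx]; ring⟩
    have h3 := (h1 (minpoly ℝ δ) w hw).2
    rw [minpoly.aeval, LinearMap.zero_apply, map_zero, eq_comm, mul_eq_zero] at h3
    rw [Polynomial.IsRoot, Polynomial.eval_map_algebraMap]
    exact h3.resolve_right hℓw
  have hder : ∀ x t, HasDerivAt (fun t ↦ ℓ (Φ t x)) (ℓ (Φ t (δ x))) t := fun x t ↦
    (LinearMap.toContinuousLinearMap ℓ).hasFDerivAt.comp_hasDerivAt t (hd x t)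
  have hs0 : s ≠ 0 := fun h ↦ hs (Or.inl h)
  -- If $\mu = 0$ and $w = \delta x$, then $\ell(\Phi_t x)$ is affine in $t$ with slope $\ell(w) \ne
  -- 0$, contradicting $\Phi_s x = x$. Otherwise $\ell(\Phi_t w) = e^{\mu t}\ell(w)$, so $e^{\mu s}
  -- = 1$.
  by_cases hμ : μ = 0
  · obtain ⟨x, hx, rfl⟩ := hw
    have hconst : ∀ t, ℓ (Φ t (δ x)) = ℓ (δ x) := fun t ↦ by
      have h4 := is_const_of_deriv_eq_zero (fun t ↦ (hder (δ x) t).differentiableAt) (fun t ↦ by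
        rw [(hder (δ x) t).deriv, hcomm, hℓ _ (hK'Φ t _ ⟨x, hx, rfl⟩), hμ, zero_mul]) t 0
      simpa [h0] using h4
    have hlin : ∀ t, HasDerivAt (fun t : ℝ ↦ ℓ (Φ t x) - t • ℓ (δ x)) 0 t := fun t ↦ by
      have h5 := (hder x t).sub ((hasDerivAt_id t).smul_const (ℓ (δ x)))
      rw [hconst, one_smul, sub_self] at h5
      exact h5
    have h6 := is_const_of_deriv_eq_zero (fun t ↦ (hlin t).differentiableAt)
      (fun t ↦ (hlin t).deriv) s 0
    simp only [(hK x).1 hx, h0, zero_smul, sub_zero, sub_eq_self, smul_eq_zero] at h6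
    exact hℓw (h6.resolve_left hs0)
  · have hexp : ∀ t : ℝ, HasDerivAt (fun t : ℝ ↦ Complex.exp (-(μ * t)) * ℓ (Φ t w)) 0 t := by
      intro t
      have h7 : HasDerivAt (fun t : ℝ ↦ Complex.exp (-(μ * t)))
          (Complex.exp (-(μ * t)) * -(μ * 1)) t :=
        ((Complex.ofRealCLM.hasDerivAt (x := t)).const_mul μ).neg.cexp
      have h8 := h7.mul (hder w t)
      rw [hcomm, hℓ _ (hK'Φ t w hw)] at h8
      have h0' : (0 : ℂ) = Complex.exp (-(μ * t)) * -(μ * 1) * ℓ (Φ t w) +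
          Complex.exp (-(μ * t)) * (μ * ℓ (Φ t w)) := by ring
      rw [h0']
      exact h8
    have h9 := is_const_of_deriv_eq_zero (fun t ↦ (hexp t).differentiableAt)
      (fun t ↦ (hexp t).deriv) s 0
    simp only [(hK w).1 (hK'K hw), h0, Complex.ofReal_zero, mul_zero, neg_zero, Complex.exp_zero,
      one_mul] at h9
    have h10 : Complex.exp (-(μ * s)) = 1 := mul_right_cancel₀ hℓw (by rw [h9, one_mul])
    rw [Complex.exp_neg, inv_eq_one, Complex.exp_eq_one_iff] at h10
    obtain ⟨n, hn⟩ := h10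
    exact hs (Or.inr (mem_biUnion hroot (mem_iUnion.2 ⟨n, hμ, hn⟩)))

/-- Apply the previous result to the flow $m \mapsto e^{td} m e^{-td}$, whose generator is the
commutator with `d`. -/
theorem exists_countable_commute_exp {R : Type*} [NormedRing R] [NormedAlgebra ℝ R]
    [FiniteDimensional ℝ R] (d : R) :
    ∃ S : Set ℝ, S.Countable ∧ ∀ s ∉ S, ∀ m : R,
      Commute (NormedSpace.exp (s • d)) m → Commute d m := by
  have : CompleteSpace R := FiniteDimensional.complete ℝ R
  let : NormedAlgebra ℚ R := NormedAlgebra.restrictScalars ℚ ℝ R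
  have hadd : ∀ (x : R) (s t : ℝ), NormedSpace.exp ((s + t) • x) =
      NormedSpace.exp (s • x) * NormedSpace.exp (t • x) := fun x s t ↦ by
    rw [add_smul, NormedSpace.exp_add_of_commute
      (((Commute.refl x).smul_left s).smul_right t)]
  have hinv : ∀ s : ℝ, NormedSpace.exp (s • d) * NormedSpace.exp (s • (-d)) = 1 := fun s ↦ by
    rw [smul_neg, ← NormedSpace.exp_add_of_commute (Commute.refl (s • d)).neg_right,
      add_neg_cancel, NormedSpace.exp_zero]
  let Φ : ℝ → R →ₗ[ℝ] R := fun t ↦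
    LinearMap.mulLeftRight ℝ (NormedSpace.exp (t • d), NormedSpace.exp (t • (-d)))
  let δ : R →ₗ[ℝ] R := LinearMap.mulLeft ℝ d - LinearMap.mulRight ℝ d
  have hΦ : ∀ t m, Φ t m = NormedSpace.exp (t • d) * m * NormedSpace.exp (t • (-d)) :=
    fun t m ↦ rfl
  have hδ : ∀ m, δ m = d * m - m * d := fun m ↦ rfl
  have hc1 : ∀ t : ℝ, Commute (NormedSpace.exp (t • d)) d := fun t ↦
    ((Commute.refl d).smul_left t).exp_left
  have hc2 : ∀ t : ℝ, Commute (NormedSpace.exp (t • (-d))) d := fun t ↦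
    ((Commute.refl d).neg_left.smul_left t).exp_left
  obtain ⟨S, hS, hSm⟩ := exists_countable_periods Φ δ (fun m ↦ by simp [hΦ])
    (fun s t m ↦ by
      rw [hΦ, hΦ, hΦ, hadd, add_comm s t, hadd]
      simp only [mul_assoc])
    (fun t m ↦ by
      rw [hΦ, hδ, hδ, hΦ, mul_sub, sub_mul]
      congr 1
      · rw [← mul_assoc _ d m, (hc1 t).eq]; simp only [mul_assoc]
      · simp only [mul_assoc]; rw [← (hc2 t).eq])
    (fun m t ↦ by
      have h1 := ((hasDerivAt_exp_smul_const (𝕂 := ℝ) d t).mul_const m).mul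
        (hasDerivAt_exp_smul_const' (𝕂 := ℝ) (-d) t)
      have h2 : Φ t (δ m) = NormedSpace.exp (t • d) * d * m * NormedSpace.exp (t • (-d)) +
          NormedSpace.exp (t • d) * m * (-d * NormedSpace.exp (t • (-d))) := by
        rw [hΦ, hδ]; noncomm_ring
      rw [h2]
      exact h1)
  refine ⟨S, hS, fun s hs m hm ↦ sub_eq_zero.1 (hSm s hs m ?_)⟩
  rw [hΦ, hm.eq, mul_assoc, hinv, mul_one]

/-! ### Differentials and vector fields in a chart -/

section TangentMaps

variable {E : Type*} [NormedAddCommGroup E] [NormedSpace ℝ E] {H : Type*} [TopologicalSpace H]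
  (I : ModelWithCorners ℝ E H) {G : Type*} [TopologicalSpace G] [ChartedSpace H G]

/-- The differential of a self-map, as an endomorphism of the model space. -/
noncomputable def tderiv (f : G → G) (x : G) : E →L[ℝ] E := mfderiv I I f x

variable {I}

theorem tderiv_id (x : G) : tderiv I (fun y : G ↦ y) x = ContinuousLinearMap.id ℝ E :=
  mfderiv_id

theorem tderiv_const (c x : G) : tderiv I (fun _ : G ↦ c) x = 0 :=
  mfderiv_const

/-- The free base point `y` with `f x = y` avoids transport between tangent spaces when `f x` equals
`y` only propositionally. -/
theorem tderiv_comp {f g : G → G} {x y : G} (hg : MDifferentiableAt I I g y)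
    (hf : MDifferentiableAt I I f x) (hy : f x = y) :
    tderiv I (fun z ↦ g (f z)) x = (tderiv I g y).comp (tderiv I f x) := by
  subst hy; exact mfderiv_comp x hg hf

theorem tderiv_comp_apply {f g : G → G} {x y : G} (hg : MDifferentiableAt I I g y)
    (hf : MDifferentiableAt I I f x) (hy : f x = y) (v : E) :
    tderiv I (fun z ↦ g (f z)) x v = tderiv I g y (tderiv I f x v) := by
  rw [tderiv_comp hg hf hy]; rfl

theorem mdifferentiableAt_of_smooth {f : G → G} (hf : ContMDiff I I ∞ f) {x : G} :
    MDifferentiableAt I I f x :=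
  hf.mdifferentiableAt (by simp)

/-- The curve `γ` is differentiable at `t`, with velocity `v`. -/
def HasVelocityAt (I : ModelWithCorners ℝ E H) (γ : ℝ → G) (t : ℝ) (v : E) : Prop :=
  HasMFDerivAt 𝓘(ℝ, ℝ) I γ t (ContinuousLinearMap.smulRight (1 : ℝ →L[ℝ] ℝ) v : ℝ →L[ℝ] E)

theorem HasVelocityAt.comp {γ : ℝ → G} {t : ℝ} {v : E} (hγ : HasVelocityAt I γ t v)
    {f : G → G} {y : G} (hf : MDifferentiableAt I I f y) (hy : γ t = y) :
    HasVelocityAt I (fun s ↦ f (γ s)) t (tderiv I f y v) := by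
  subst hy
  have h1 : HasMFDerivAt 𝓘(ℝ, ℝ) I (fun s ↦ f (γ s)) t
      ((tderiv (E := E) I f (γ t)).comp
        (ContinuousLinearMap.smulRight (1 : ℝ →L[ℝ] ℝ) v) : ℝ →L[ℝ] E) :=
    HasMFDerivAt.comp t hf.hasMFDerivAt hγ
  have h2 : (tderiv (E := E) I f (γ t)).comp
      (ContinuousLinearMap.smulRight (1 : ℝ →L[ℝ] ℝ) v) =
      ContinuousLinearMap.smulRight (1 : ℝ →L[ℝ] ℝ) (tderiv I f (γ t) v) := by
    ext; simp
  exact (congrArg (fun L : ℝ →L[ℝ] E ↦ HasMFDerivAt 𝓘(ℝ, ℝ) I (fun s ↦ f (γ s)) t L) h2).mp h1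

theorem HasVelocityAt.unique {γ : ℝ → G} {t : ℝ} {v w : E} (hv : HasVelocityAt I γ t v)
    (hw : HasVelocityAt I γ t w) : v = w := by
  have h1 : (ContinuousLinearMap.smulRight (1 : ℝ →L[ℝ] ℝ) v : ℝ →L[ℝ] E) =
      ContinuousLinearMap.smulRight (1 : ℝ →L[ℝ] ℝ) w := hasMFDerivAt_unique hv hw
  simpa using congrArg (fun L : ℝ →L[ℝ] E ↦ L 1) h1

theorem totalSpace_mk_congr {g h : G} (hg : g = h) {v w : E} (hv : v = w) :
    (⟨g, v⟩ : TangentBundle I G) = ⟨h, w⟩ := by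
  subst hg hv; rfl

/-- The differential of the preferred chart at `x₀`, as an endomorphism of the model space. -/
noncomputable def chartDeriv (I : ModelWithCorners ℝ E H) (x₀ x : G) : E →L[ℝ] E :=
  mfderiv I 𝓘(ℝ, E) (extChartAt I x₀) x

/-- A vector field read in the preferred chart at `x₀`. -/
noncomputable def chartField (x₀ : G) (V : ∀ g : G, TangentSpace I g) (u : E) : E :=
  chartDeriv I x₀ ((extChartAt I x₀).symm u) (V ((extChartAt I x₀).symm u))

theorem eventually_symm_mem_source [I.Boundaryless] (x₀ : G) :
    ∀ᶠ u in 𝓝 (extChartAt I x₀ x₀),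
      (extChartAt I x₀).symm u ∈ (extChartAt I x₀).source := by
  filter_upwards [extChartAt_target_mem_nhds (I := I) x₀] with u hu
  exact (extChartAt I x₀).map_target hu

variable [IsManifold I 1 G]

theorem chartDeriv_self (x₀ : G) : chartDeriv I x₀ x₀ = ContinuousLinearMap.id ℝ E :=
  mfderiv_extChartAt_self

theorem chartField_self (x₀ : G) (V : ∀ g : G, TangentSpace I g) :
    chartField x₀ V (extChartAt I x₀ x₀) = V x₀ := by
  rw [chartField, extChartAt_to_inv, chartDeriv_self]; rfl

variable [I.Boundaryless]

theorem fderiv_extChartAt_comp {x₀ : G} {h : G → G} (hh : MDifferentiableAt I I h x₀)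
    (hs : h x₀ ∈ (extChartAt I x₀).source) :
    fderiv ℝ (fun u ↦ extChartAt I x₀ (h ((extChartAt I x₀).symm u))) (extChartAt I x₀ x₀) =
      (chartDeriv I x₀ (h x₀)).comp (tderiv I h x₀) := by
  have he : (mfderivWithin 𝓘(ℝ, E) I (extChartAt I x₀).symm (range I) (extChartAt I x₀ x₀) :
      E →L[ℝ] E) = ContinuousLinearMap.id ℝ E := mfderivWithin_range_extChartAt_symm
  have h1 : HasMFDerivAt 𝓘(ℝ, E) I (extChartAt I x₀).symm (extChartAt I x₀ x₀)
      (ContinuousLinearMap.id ℝ E : E →L[ℝ] E) :=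
    (congrArg (fun L : E →L[ℝ] E ↦ HasMFDerivAt 𝓘(ℝ, E) I (extChartAt I x₀).symm
      (extChartAt I x₀ x₀) L) he).mp
      ((mdifferentiableWithinAt_extChartAt_symm
        (mem_extChartAt_target (I := I) x₀)).hasMFDerivWithinAt.hasMFDerivAt
        (by rw [I.range_eq_univ]; exact univ_mem))
  have h3 : HasMFDerivAt I 𝓘(ℝ, E) (extChartAt I x₀) (h x₀)
      (chartDeriv (E := E) I x₀ (h x₀)) :=
    (mdifferentiableAt_extChartAt (by rwa [← extChartAt_source (I := I)])).hasMFDerivAt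
  have h4 : HasMFDerivAt I 𝓘(ℝ, E) (fun x ↦ extChartAt I x₀ (h x)) x₀
      ((chartDeriv (E := E) I x₀ (h x₀)).comp (tderiv (E := E) I h x₀)) :=
    HasMFDerivAt.comp x₀ h3 hh.hasMFDerivAt
  have h5 : HasMFDerivAt 𝓘(ℝ, E) 𝓘(ℝ, E)
      (fun u ↦ extChartAt I x₀ (h ((extChartAt I x₀).symm u))) (extChartAt I x₀ x₀)
      (((chartDeriv (E := E) I x₀ (h x₀)).comp (tderiv (E := E) I h x₀)).comp
        (ContinuousLinearMap.id ℝ E) : E →L[ℝ] E) :=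
    HasMFDerivAt.comp (extChartAt I x₀ x₀)
      (f := (extChartAt I x₀).symm) (by rw [extChartAt_to_inv]; exact h4) h1
  have h6 : HasFDerivAt (fun u ↦ extChartAt I x₀ (h ((extChartAt I x₀).symm u)))
      ((chartDeriv (E := E) I x₀ (h x₀)).comp (tderiv (E := E) I h x₀)) (extChartAt I x₀ x₀) :=
    hasMFDerivAt_iff_hasFDerivAt.mp h5
  exact h6.fderiv

/-- The preferred chart has identity differential at its base point, so there the bracket is the
coordinate formula with no correcting factor. -/
theorem mlieBracket_eq_chartField (x₀ : G) (V W : ∀ g : G, TangentSpace I g) :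
    (VectorField.mlieBracket I V W x₀ : E) =
      fderiv ℝ (chartField x₀ W) (extChartAt I x₀ x₀) (V x₀) -
        fderiv ℝ (chartField x₀ V) (extChartAt I x₀ x₀) (W x₀) := by
  have key : ∀ U : (∀ g : G, TangentSpace I g),
      (VectorField.mpullbackWithin 𝓘(ℝ, E) I (extChartAt I x₀).symm U (range I) : E → E)
        =ᶠ[𝓝 (extChartAt I x₀ x₀)] chartField x₀ U := by
    intro U
    filter_upwards [extChartAt_target_mem_nhds (I := I) x₀] with u hu
    rw [VectorField.mpullbackWithin_apply, ContinuousLinearMap.inverse_eq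
      (mfderivWithin_extChartAt_symm_comp_mfderiv_extChartAt hu)
      (mfderiv_extChartAt_comp_mfderivWithin_extChartAt_symm hu)]
    rfl
  have hinv : ∀ L : E →L[ℝ] E, L = ContinuousLinearMap.id ℝ E → ∀ w, L.inverse w = w := by
    rintro _ rfl w
    rw [ContinuousLinearMap.inverse_id]; rfl
  have hlie : ∀ v w : E → E, v =ᶠ[𝓝 (extChartAt I x₀ x₀)] chartField x₀ V →
      w =ᶠ[𝓝 (extChartAt I x₀ x₀)] chartField x₀ W →
      VectorField.lieBracketWithin ℝ v w ((extChartAt I x₀).symm ⁻¹' univ ∩ range I)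
        (extChartAt I x₀ x₀) = fderiv ℝ (chartField x₀ W) (extChartAt I x₀ x₀) (V x₀) -
        fderiv ℝ (chartField x₀ V) (extChartAt I x₀ x₀) (W x₀) := by
    intro v w hv hw
    rw [preimage_univ, univ_inter, I.range_eq_univ, VectorField.lieBracketWithin_univ,
      VectorField.lieBracket, hv.fderiv_eq, hw.fderiv_eq, hv.eq_of_nhds, hw.eq_of_nhds,
      chartField_self, chartField_self]
  rw [← VectorField.mlieBracketWithin_univ, VectorField.mlieBracketWithin_apply]
  exact (hinv _ mfderiv_extChartAt_self _).trans (hlie _ _ (key V) (key W))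

end TangentMaps

/-! ### Invariant fields and the derivative of the adjoint representation -/

section LieGroups

variable {E : Type*} [NormedAddCommGroup E] [NormedSpace ℝ E] {H : Type*} [TopologicalSpace H]
  {I : ModelWithCorners ℝ E H} {G : Type*} [TopologicalSpace G] [ChartedSpace H G] [Group G]


theorem rightInvariantField_one (X : GroupLieAlgebra I G) :
    (rightInvariantField X (1 : G) : E) = X := by
  have : (fun x : G ↦ x * 1) = fun x ↦ x := by ext x; simp
  change tderiv I (fun x : G ↦ x * 1) 1 X = X
  rw [this, tderiv_id]; rfl

/-- The adjoint representation with values in the endomorphisms of the model space. -/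
noncomputable def adjointRep (I : ModelWithCorners ℝ E H) (g : G) : E →L[ℝ] E :=
  tderiv I (fun x : G ↦ g * x * g⁻¹) 1

theorem adjointRep_one : adjointRep I (1 : G) = 1 := by
  have : (fun x : G ↦ 1 * x * 1⁻¹) = fun x ↦ x := by ext x; simp
  rw [adjointRep, this, tderiv_id]; rfl

variable [LieGroup I ∞ G]

theorem smooth_mul_const (g : G) : ContMDiff I I ∞ (fun x : G ↦ x * g) :=
  contMDiff_mul_right

theorem smooth_const_mul (g : G) : ContMDiff I I ∞ (fun x : G ↦ g * x) :=
  contMDiff_mul_left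

theorem smooth_inv : ContMDiff I I ∞ (fun x : G ↦ x⁻¹) := contMDiff_inv I ∞

theorem smooth_conj (g : G) : ContMDiff I I ∞ (fun x : G ↦ g * x * g⁻¹) :=
  (smooth_mul_const g⁻¹).comp (smooth_const_mul g)

theorem smooth_conj_left (g : G) : ContMDiff I I ∞ (fun a : G ↦ a * g * a⁻¹) :=
  (smooth_mul_const g).mul smooth_inv

theorem tderiv_mul {f h : G → G} {x : G} (hf : MDifferentiableAt I I f x)
    (hh : MDifferentiableAt I I h x) (v : E) :
    tderiv I (fun a ↦ f a * h a) x v =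
      tderiv I (fun y ↦ y * h x) (f x) (tderiv I f x v) +
        tderiv I (fun y ↦ f x * y) (h x) (tderiv I h x v) := by
  have h1 : MDifferentiableAt (I.prod I) I (fun p : G × G ↦ p.1 * p.2) (f x, h x) :=
    (contMDiff_mul I ∞).mdifferentiableAt (by simp)
  have h2 := mfderiv_comp x (f := fun a ↦ (f a, h a)) h1 (hf.prodMk hh)
  have h3 : tderiv I (fun a ↦ f a * h a) x v =
      mfderiv (I.prod I) I (fun p : G × G ↦ p.1 * p.2) (f x, h x)
        (mfderiv I (I.prod I) (fun a ↦ (f a, h a)) x v) :=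
    congrArg (fun L : E →L[ℝ] E ↦ L v) h2
  rw [h3, mfderiv_prod_eq_add_apply h1, hf.mfderiv_prod hh]
  rfl

theorem tderiv_inv_one (v : E) : tderiv I (fun x : G ↦ x⁻¹) 1 v = -v := by
  have h1 := tderiv_mul (I := I) (x := (1 : G)) (mdifferentiableAt_of_smooth contMDiff_id)
    (mdifferentiableAt_of_smooth smooth_inv) v
  simp only [id, mul_inv_cancel, inv_one, mul_one, one_mul] at h1
  rw [tderiv_const, tderiv_id] at h1
  change 0 = tderiv I (fun y : G ↦ y) 1 v + tderiv I (fun x : G ↦ x⁻¹) 1 v at h1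
  rw [tderiv_id] at h1
  exact (neg_eq_of_add_eq_zero_right h1.symm).symm

/-- Differentiate $(xg^{-1})^{-1} = g x^{-1}$ at $x = e$. -/
theorem tderiv_inv_comp_mul_const (X : E) (g : G) :
    tderiv I (fun x : G ↦ x⁻¹) g⁻¹ (tderiv I (fun x : G ↦ x * g⁻¹) 1 X) =
      -tderiv I (fun x : G ↦ g * x) 1 X := by
  have h1 := tderiv_comp_apply (I := I) (x := (1 : G)) (y := g⁻¹)
    (mdifferentiableAt_of_smooth smooth_inv)
    (mdifferentiableAt_of_smooth (smooth_mul_const g⁻¹)) (one_mul _) X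
  have h2 := tderiv_comp_apply (I := I) (x := (1 : G)) (y := 1)
    (mdifferentiableAt_of_smooth (smooth_const_mul g))
    (mdifferentiableAt_of_smooth smooth_inv) inv_one X
  have h3 : (fun z : G ↦ (z * g⁻¹)⁻¹) = fun z ↦ g * z⁻¹ := by ext z; simp
  rw [h3, h2, tderiv_inv_one, map_neg] at h1
  exact h1.symm

theorem invPushforward_rightInvariantField (X : GroupLieAlgebra I G) (g : G) :
    invPushforward (rightInvariantField X) g = -mulInvariantVectorField X g :=
  tderiv_inv_comp_mul_const (E := E) X g

theorem tderiv_conj_left (X : E) (g : G) :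
    tderiv I (fun a : G ↦ a * g * a⁻¹) 1 X =
      tderiv I (fun x : G ↦ x * g) 1 X - tderiv I (fun x : G ↦ g * x) 1 X := by
  have h1 := tderiv_mul (I := I) (x := (1 : G))
    (mdifferentiableAt_of_smooth (smooth_mul_const g))
    (mdifferentiableAt_of_smooth smooth_inv) X
  rw [tderiv_inv_one, map_neg] at h1
  simp only [inv_one, mul_one, one_mul] at h1
  rw [tderiv_id] at h1
  rw [sub_eq_add_neg]
  exact h1

/-- This is why $X + I_*X$ generates the conjugations by $\exp(tX)$. -/
theorem rightInvariantField_add_invPushforward (X : GroupLieAlgebra I G) (g : G) :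
    (rightInvariantField X g + invPushforward (rightInvariantField X) g : E) =
      tderiv I (fun a : G ↦ a * g * a⁻¹) 1 X := by
  rw [invPushforward_rightInvariantField]
  exact ((tderiv_conj_left (E := E) X g).trans (sub_eq_add_neg _ _)).symm

variable [I.Boundaryless]

theorem contDiffAt_chart_map {F : G × G → G} (hF : ContMDiff (I.prod I) I ∞ F)
    (h1 : F (1, 1) = 1) :
    ContDiffAt ℝ ∞ (fun p : E × E ↦ extChartAt I (1 : G)
      (F ((extChartAt I (1 : G)).symm p.1, (extChartAt I (1 : G)).symm p.2)))
      (extChartAt I (1 : G) 1, extChartAt I (1 : G) 1) := by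
  have hsymm : ContMDiffAt 𝓘(ℝ, E) I ∞ (extChartAt I (1 : G)).symm (extChartAt I (1 : G) 1) :=
    (contMDiffOn_extChartAt_symm (1 : G)).contMDiffAt (extChartAt_target_mem_nhds (1 : G))
  have hfst : ContMDiffAt 𝓘(ℝ, E × E) I ∞ (fun p : E × E ↦ (extChartAt I (1 : G)).symm p.1)
      (extChartAt I (1 : G) 1, extChartAt I (1 : G) 1) :=
    ContMDiffAt.comp (g := (extChartAt I (1 : G)).symm) _ hsymm
      contDiff_fst.contMDiff.contMDiffAt
  have hsnd : ContMDiffAt 𝓘(ℝ, E × E) I ∞ (fun p : E × E ↦ (extChartAt I (1 : G)).symm p.2)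
      (extChartAt I (1 : G) 1, extChartAt I (1 : G) 1) :=
    ContMDiffAt.comp (g := (extChartAt I (1 : G)).symm) _ hsymm
      contDiff_snd.contMDiff.contMDiffAt
  have hcomp := ContMDiffAt.comp (extChartAt I (1 : G) 1, extChartAt I (1 : G) 1)
    (g := F) hF.contMDiffAt (hfst.prodMk hsnd)
  rw [← contMDiffAt_iff_contDiffAt]
  refine ContMDiffAt.comp (g := extChartAt I (1 : G)) _ ?_ hcomp
  simp only [extChartAt_to_inv, h1]
  exact contMDiffAt_extChartAt

theorem chartField_eventuallyEq {F : G × G → G} (hF : ContMDiff (I.prod I) I ∞ F)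
    (h1 : ∀ x, F (1, x) = x) {Z : E} {V : ∀ g : G, TangentSpace I g}
    (hV : ∀ g, (V g : E) = tderiv I (fun a ↦ F (a, g)) 1 Z) :
    chartField 1 V =ᶠ[𝓝 (extChartAt I (1 : G) 1)] fun u ↦
      fderiv ℝ (fun w ↦ extChartAt I (1 : G)
        (F ((extChartAt I (1 : G)).symm w, (extChartAt I (1 : G)).symm u)))
        (extChartAt I (1 : G) 1) Z := by
  filter_upwards [eventually_symm_mem_source (I := I) (1 : G)] with u hu
  have hd : ContMDiff I I ∞ (fun a ↦ F (a, (extChartAt I (1 : G)).symm u)) :=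
    hF.comp (contMDiff_id.prodMk contMDiff_const)
  have h2 := fderiv_extChartAt_comp (mdifferentiableAt_of_smooth hd (x := (1 : G)))
    (by rw [h1]; exact hu)
  rw [h2, h1, chartField]
  exact congrArg _ (hV _)

theorem tderiv_eventuallyEq {F : G × G → G} (hF : ContMDiff (I.prod I) I ∞ F)
    (h1 : ∀ a, F (a, 1) = 1) :
    (fun w ↦ tderiv I (fun x ↦ F ((extChartAt I (1 : G)).symm w, x)) 1)
      =ᶠ[𝓝 (extChartAt I (1 : G) 1)] fun w ↦
      fderiv ℝ (fun u ↦ extChartAt I (1 : G)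
        (F ((extChartAt I (1 : G)).symm w, (extChartAt I (1 : G)).symm u)))
        (extChartAt I (1 : G) 1) := by
  refine Eventually.of_forall fun w ↦ ?_
  have hd : ContMDiff I I ∞ (fun x ↦ F ((extChartAt I (1 : G)).symm w, x)) :=
    hF.comp (contMDiff_const.prodMk contMDiff_id)
  have h2 := fderiv_extChartAt_comp (mdifferentiableAt_of_smooth hd (x := (1 : G)))
    (by rw [h1]; exact mem_extChartAt_source _)
  rw [h1, chartDeriv_self, ContinuousLinearMap.id_comp] at h2
  exact h2.symm

/-- Let `M` and `B` be the mixed second derivatives at $e$, in a chart, of multiplication and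
conjugation. Right and left invariant fields have derivatives `M Z` and `M.flip Z`, so $X + I_*X$
gives `B Z = M Z - M.flip Z`. Both brackets are then read off in coordinates; for `derivationOf` one
term drops out because the field vanishes at $e$. -/
theorem exists_derivative_adjointRep [CompleteSpace E] :
    ∃ B : E →L[ℝ] E →L[ℝ] E,
      HasStrictFDerivAt (fun w ↦ adjointRep I ((extChartAt I (1 : G)).symm w)) B
        (extChartAt I (1 : G) 1) ∧
      (∀ Z Y : GroupLieAlgebra I G, B Z Y = ⁅Z, Y⁆) ∧
      ∀ (Z : GroupLieAlgebra I G) (V : ∀ g : G, TangentSpace I g),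
        (∀ g, V g = rightInvariantField Z g + invPushforward (rightInvariantField Z) g) →
        ∀ Y : GroupLieAlgebra I G, B Z Y = derivationOf V Y := by
  have hFm : ContMDiff (I.prod I) I ∞ (fun p : G × G ↦ p.1 * p.2) := contMDiff_mul I ∞
  have hFo : ContMDiff (I.prod I) I ∞ (fun p : G × G ↦ p.2 * p.1) :=
    contMDiff_snd.mul contMDiff_fst
  have hFc : ContMDiff (I.prod I) I ∞ (fun p : G × G ↦ p.1 * p.2 * p.1⁻¹) :=
    hFm.mul contMDiff_fst.inv
  obtain ⟨M, hM1, hM2⟩ := exists_mixed_derivative (contDiffAt_chart_map hFm (one_mul 1))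
  obtain ⟨B, hB1, hB2⟩ := exists_mixed_derivative (contDiffAt_chart_map hFc (by simp))
  have hR : ∀ Z : GroupLieAlgebra I G, HasFDerivAt (chartField (E := E) 1 (rightInvariantField Z))
      (M Z) (extChartAt I (1 : G) 1) := fun Z ↦
    (hM2 Z).congr_of_eventuallyEq
      (chartField_eventuallyEq hFm (fun x ↦ one_mul x) (fun _ ↦ rfl))
  have hL : ∀ Y : GroupLieAlgebra I G, HasFDerivAt
      (chartField (E := E) 1 (mulInvariantVectorField Y)) (M.flip Y) (extChartAt I (1 : G) 1) :=
    fun Y ↦ by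
    have h1 : HasFDerivAt (fun w ↦ fderiv ℝ (fun v ↦ extChartAt I (1 : G)
        ((extChartAt I (1 : G)).symm w * (extChartAt I (1 : G)).symm v))
        (extChartAt I (1 : G) 1) (Y : E)) (M.flip Y) (extChartAt I (1 : G) 1) :=
      (ContinuousLinearMap.apply (E := E) ℝ E Y).hasFDerivAt.comp _ hM1.hasFDerivAt
    exact h1.congr_of_eventuallyEq
      (chartField_eventuallyEq hFo (fun x ↦ mul_one x) (fun _ ↦ rfl))
  have hC : ∀ (Z : GroupLieAlgebra I G) (V : ∀ g : G, TangentSpace I g),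
      (∀ g, V g = rightInvariantField Z g + invPushforward (rightInvariantField Z) g) →
      HasFDerivAt (chartField (E := E) 1 V) (B Z) (extChartAt I (1 : G) 1) := fun Z V hV ↦
    (hB2 Z).congr_of_eventuallyEq
      (chartField_eventuallyEq hFc (fun x ↦ by simp) (fun g ↦ by
        exact (hV g).trans (rightInvariantField_add_invPushforward Z g)))
  have hBM : ∀ Z : GroupLieAlgebra I G, B Z = M Z - M.flip Z := fun Z ↦ by
    refine (hC Z _ fun g ↦ rfl).unique (((hR Z).sub (hL Z)).congr_of_eventuallyEq ?_)
    refine Eventually.of_forall fun u ↦ ?_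
    simp only [invPushforward_rightInvariantField, ← sub_eq_add_neg]
    exact map_sub (chartDeriv (E := E) I (1 : G) _) _ _
  have hleft : ∀ Y : GroupLieAlgebra I G, (mulInvariantVectorField Y (1 : G) : E) = Y := fun Y ↦ by
    have : (fun x : G ↦ 1 * x) = fun x ↦ x := by ext x; simp
    change tderiv I (fun x : G ↦ 1 * x) 1 Y = Y
    rw [this, tderiv_id]; rfl
  refine ⟨B, hB1.congr_of_eventuallyEq
    (tderiv_eventuallyEq hFc (fun a ↦ by simp)).symm, fun Z Y ↦ ?_, fun Z V hV Y ↦ ?_⟩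
  · refine Eq.trans ?_ (mlieBracket_eq_chartField (1 : G) (mulInvariantVectorField Z)
      (mulInvariantVectorField Y)).symm
    rw [(hL Z).fderiv, (hL Y).fderiv, hleft, hleft, hBM]
    rfl
  · have hV1 : (V 1 : E) = 0 := by
      have h2 := rightInvariantField_add_invPushforward Z (1 : G)
      have h3 : (fun a : G ↦ a * 1 * a⁻¹) = fun _ ↦ 1 := by ext x; simp
      rw [h3, tderiv_const] at h2
      exact (hV 1).trans h2
    refine Eq.trans ?_ (congrArg Neg.neg (mlieBracket_eq_chartField (1 : G) V
      (mulInvariantVectorField Y))).symm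
    have hfin : ∀ (L : E →L[ℝ] E) (x y : E), x = 0 → y = -(L x - y) := by
      rintro L _ y rfl
      simp
    rw [(hC Z V hV).fderiv, hleft]
    exact hfin _ _ _ hV1

end LieGroups

/-! ### Kernel of the adjoint representation and one-parameter subgroups -/

section LieGroups

variable {E : Type*} [NormedAddCommGroup E] [NormedSpace ℝ E] {H : Type*} [TopologicalSpace H]
  {I : ModelWithCorners ℝ E H} {G : Type*} [TopologicalSpace G] [ChartedSpace H G] [Group G]
  [LieGroup I ∞ G]

theorem adjointRep_mul (g h : G) : adjointRep I (g * h) = adjointRep I g * adjointRep I h := by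
  have : (fun x : G ↦ g * h * x * (g * h)⁻¹) = fun x ↦ g * (h * x * h⁻¹) * g⁻¹ := by
    ext x; group
  rw [adjointRep, this]
  exact tderiv_comp (mdifferentiableAt_of_smooth (smooth_conj g))
    (mdifferentiableAt_of_smooth (smooth_conj h)) (by simp)

/-- The adjoint representation as a monoid homomorphism. -/
noncomputable def adjointHom (I : ModelWithCorners ℝ E H) [LieGroup I ∞ G] :
    G →* (E →L[ℝ] E) where
  toFun := adjointRep I
  map_one' := adjointRep_one
  map_mul' := adjointRep_mul

theorem continuous_adjointRep [CompleteSpace E] [I.Boundaryless] :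
    Continuous (adjointRep I : G → E →L[ℝ] E) := by
  have : IsTopologicalGroup G := topologicalGroup_of_lieGroup I ∞
  obtain ⟨B, hB, -, -⟩ := exists_derivative_adjointRep (I := I) (G := G)
  have h1 : ContinuousAt (adjointRep I : G → E →L[ℝ] E) 1 := by
    have h2 := ContinuousAt.comp (f := extChartAt I (1 : G))
      (g := fun w ↦ adjointRep I ((extChartAt I (1 : G)).symm w)) hB.hasFDerivAt.continuousAt
      (continuousAt_extChartAt (1 : G))
    refine h2.congr ?_
    filter_upwards [extChartAt_source_mem_nhds (I := I) (1 : G)] with a ha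
    exact congrArg _ ((extChartAt I (1 : G)).left_inv ha)
  refine continuous_iff_continuousAt.2 fun g ↦ ?_
  have h3 : (adjointRep I : G → E →L[ℝ] E) =
      fun a ↦ adjointRep I g * adjointRep I (g⁻¹ * a) := by
    ext1 a
    rw [← adjointRep_mul, mul_inv_cancel_left]
  rw [h3]
  have h4 : ContinuousAt (fun a ↦ g⁻¹ * a) g := by fun_prop
  have h5 : ContinuousAt (adjointRep I : G → E →L[ℝ] E) (g⁻¹ * g) := by rwa [inv_mul_cancel]
  exact continuousAt_const.mul (h5.comp h4)

/-- A trivial centre makes the derivative of $\mathrm{Ad}$ injective, so the kernel is discrete; it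
is also closed in a compact group. -/
theorem finite_ker_adjointHom [FiniteDimensional ℝ E] [CompleteSpace E] [I.Boundaryless]
    [CompactSpace G] 
    (hc : ∀ Z : GroupLieAlgebra I G, (∀ Y : GroupLieAlgebra I G, ⁅Z, Y⁆ = 0) → Z = 0) :
    Finite (adjointHom (G := G) I).ker := by
  have : IsTopologicalGroup G := topologicalGroup_of_lieGroup I ∞
  obtain ⟨B, hB, hbr, -⟩ := exists_derivative_adjointRep (I := I) (G := G)
  have hinj : Function.Injective B := by
    refine (injective_iff_map_eq_zero B).2 fun Z hZ ↦ hc Z fun Y ↦ ?_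
    exact (hbr Z Y).symm.trans (congrArg (fun L : E →L[ℝ] E ↦ L Y) hZ)
  obtain ⟨s, hs, hsinj⟩ := exists_injOn_nhds_of_injective hB hinj
  have hU : ∀ᶠ a in 𝓝 (1 : G), adjointRep I a = 1 → a = 1 := by
    filter_upwards [extChartAt_source_mem_nhds (I := I) (1 : G),
      (continuousAt_extChartAt (I := I) (1 : G)).preimage_mem_nhds hs] with a ha has h1
    have h2 := hsinj has (mem_of_mem_nhds hs) (by
      simp only [(extChartAt I (1 : G)).left_inv ha, extChartAt_to_inv, h1, adjointRep_one])
    exact (extChartAt I (1 : G)).injOn ha (mem_extChartAt_source _) h2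
  have hdisc : DiscreteTopology (adjointHom (G := G) I).ker := by
    rw [discreteTopology_iff_isOpen_singleton_one, isOpen_iff_mem_nhds]
    rintro _ rfl
    filter_upwards [(continuous_subtype_val.tendsto (1 : (adjointHom (G := G) I).ker)).eventually
      hU] with a ha
    exact Subtype.ext (ha (MonoidHom.mem_ker.1 a.2))
  have hclosed : IsClosed ((adjointHom (G := G) I).ker : Set G) := by
    have : ((adjointHom (G := G) I).ker : Set G) = adjointRep I ⁻¹' {1} := by
      ext g; exact MonoidHom.mem_ker
    rw [this]
    exact isClosed_singleton.preimage continuous_adjointRep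
  have : CompactSpace (adjointHom (G := G) I).ker := isCompact_iff_compactSpace.1 hclosed.isCompact
  exact finite_of_compact_of_discrete

theorem HasVelocityAt.mul {f h : ℝ → G} {t : ℝ} {v w : E} (hf : HasVelocityAt I f t v)
    (hh : HasVelocityAt I h t w) :
    HasVelocityAt I (fun s ↦ f s * h s) t
      (tderiv I (fun y ↦ y * h t) (f t) v + tderiv I (fun y ↦ f t * y) (h t) w) := by
  have h1 : MDifferentiableAt (I.prod I) I (fun p : G × G ↦ p.1 * p.2) (f t, h t) :=
    (contMDiff_mul I ∞).mdifferentiableAt (by simp)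
  have h2 : HasMFDerivAt 𝓘(ℝ, ℝ) I (fun s ↦ f s * h s) t
      ((mfderiv (I.prod I) I (fun p : G × G ↦ p.1 * p.2) (f t, h t) : E × E →L[ℝ] E).comp
        ((ContinuousLinearMap.smulRight (1 : ℝ →L[ℝ] ℝ) v).prod
          (ContinuousLinearMap.smulRight (1 : ℝ →L[ℝ] ℝ) w)) : ℝ →L[ℝ] E) :=
    HasMFDerivAt.comp t h1.hasMFDerivAt (hf.prodMk hh)
  have h3 : ((mfderiv (I.prod I) I (fun p : G × G ↦ p.1 * p.2) (f t, h t) : E × E →L[ℝ] E).comp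
        ((ContinuousLinearMap.smulRight (1 : ℝ →L[ℝ] ℝ) v).prod
          (ContinuousLinearMap.smulRight (1 : ℝ →L[ℝ] ℝ) w)) : ℝ →L[ℝ] E) =
      ContinuousLinearMap.smulRight (1 : ℝ →L[ℝ] ℝ)
        (tderiv I (fun y ↦ y * h t) (f t) v + tderiv I (fun y ↦ f t * y) (h t) w) := by
    have key : ∀ (L : E × E →L[ℝ] E) (z : E), L (v, w) = z →
        L.comp ((ContinuousLinearMap.smulRight (1 : ℝ →L[ℝ] ℝ) v).prod
          (ContinuousLinearMap.smulRight (1 : ℝ →L[ℝ] ℝ) w)) =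
          ContinuousLinearMap.smulRight (1 : ℝ →L[ℝ] ℝ) z := by
      rintro L _ rfl
      ext; simp
    exact key _ _ (mfderiv_prod_eq_add_apply (v := ((v, w) : E × E)) h1)
  exact (congrArg (fun L : ℝ →L[ℝ] E ↦ HasMFDerivAt 𝓘(ℝ, ℝ) I (fun s ↦ f s * h s) t L) h3).mp h2

theorem tangentMap_mul (p q : TangentBundle I G) :
    tangentMap (I.prod I) I (fun p : G × G ↦ p.1 * p.2)
      ((equivTangentBundleProd I G I G).symm (p, q)) =
      ⟨p.1 * q.1, (tderiv I (fun y ↦ y * q.1) p.1 p.2 +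
        tderiv I (fun y ↦ p.1 * y) q.1 q.2 : E)⟩ := by
  have h1 : MDifferentiableAt (I.prod I) I (fun p : G × G ↦ p.1 * p.2) (p.1, q.1) :=
    (contMDiff_mul I ∞).mdifferentiableAt (by simp)
  exact totalSpace_mk_congr rfl (mfderiv_prod_eq_add_apply (v := ((p.2, q.2) : E × E)) h1)

theorem smooth_tangentMap_mul :
    ContMDiff (I.tangent.prod I.tangent) I.tangent ∞ (fun p : TangentBundle I G × TangentBundle I G ↦
      (⟨p.1.1 * p.2.1, (tderiv I (fun y ↦ y * p.2.1) p.1.1 p.1.2 +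
        tderiv I (fun y ↦ p.1.1 * y) p.2.1 p.2.2 : E)⟩ : TangentBundle I G)) := by
  have S₂ : ContMDiff (I.tangent.prod I.tangent) (I.prod I).tangent ∞
      (equivTangentBundleProd I G I G).symm := contMDiff_equivTangentBundleProd_symm
  have S₃ : ContMDiff (I.prod I).tangent I.tangent ∞
      (tangentMap (I.prod I) I (fun p : G × G ↦ p.1 * p.2)) :=
    (contMDiff_mul I ∞).contMDiff_tangentMap (m := ∞) le_rfl
  exact (S₃.comp S₂).congr fun p ↦ (tangentMap_mul p.1 p.2).symm

theorem smooth_rightInvariantField (X : GroupLieAlgebra I G) :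
    IsSmoothField I (rightInvariantField X : ∀ g : G, TangentSpace I g) := by
  let F₁ : G → TangentBundle I G × TangentBundle I G :=
    fun g ↦ (⟨(1 : G), X⟩, ⟨g, (0 : TangentSpace I g)⟩)
  have S₁ : ContMDiff I (I.tangent.prod I.tangent) ∞ F₁ :=
    contMDiff_const.prodMk (Bundle.contMDiff_zeroSection ℝ _)
  refine (smooth_tangentMap_mul.comp S₁).congr fun g ↦ ?_
  have hL : ∀ (L : E →L[ℝ] E) (v : E), v = v + L 0 := fun L v ↦ by simp
  exact totalSpace_mk_congr (one_mul g).symm (hL _ _)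

theorem IsSmoothField.contMDiff_one {V : ∀ g : G, TangentSpace I g} (hV : IsSmoothField I V) :
    ContMDiff I I.tangent 1 (fun g ↦ (⟨g, V g⟩ : TangentBundle I G)) :=
  ContMDiff.of_le hV ENat.LEInfty.out

theorem tderiv_rightInvariantField (X : GroupLieAlgebra I G) (g x : G) :
    tderiv I (fun y ↦ y * x) g (rightInvariantField X g) = rightInvariantField X (g * x) := by
  have h1 := tderiv_comp_apply (E := E) (x := (1 : G)) (y := g)
    (mdifferentiableAt_of_smooth (smooth_mul_const (I := I) x))
    (mdifferentiableAt_of_smooth (smooth_mul_const g)) (one_mul g) X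
  have h2 : (fun z : G ↦ z * g * x) = fun z ↦ z * (g * x) := by ext z; rw [mul_assoc]
  rw [h2] at h1
  exact h1.symm

/-- Right translates of a local solution through $e$ exist for the same time at every point, and
such a uniform time makes solutions global. -/
theorem exists_one_parameter_curve [CompleteSpace E] [I.Boundaryless] [T2Space G]
    (X : GroupLieAlgebra I G) :
    ∃ γ : ℝ → G, γ 0 = 1 ∧ IsMIntegralCurve (I := I) γ (rightInvariantField X) := by
  have hv := (smooth_rightInvariantField X).contMDiff_one
  obtain ⟨γ, h0, hγ⟩ := exists_isMIntegralCurveAt_of_contMDiffAt_boundaryless (I := I)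
    (t₀ := 0) (hv.contMDiffAt (x := (1 : G)))
  obtain ⟨ε, hε, hγ⟩ := isMIntegralCurveAt_iff'.1 hγ
  rw [Real.ball_eq_Ioo, zero_sub, zero_add] at hγ
  refine exists_isMIntegralCurve_of_isMIntegralCurveOn hv hε (fun x ↦ ?_) 1
  refine ⟨fun t ↦ γ t * x, by simp [h0], fun t ht ↦ ?_⟩
  have h1 : HasVelocityAt (E := E) I γ t (rightInvariantField X (γ t)) :=
    (hγ t ht).hasMFDerivAt (isOpen_Ioo.mem_nhds ht)
  have h2 := h1.comp (mdifferentiableAt_of_smooth (smooth_mul_const x)) rfl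
  rw [tderiv_rightInvariantField] at h2
  exact HasMFDerivAt.hasMFDerivWithinAt h2

section Curve

variable [I.Boundaryless] [T2Space G] {X : GroupLieAlgebra I G} {γ : ℝ → G}

theorem one_parameter_add (h0 : γ 0 = 1)
    (hγ : IsMIntegralCurve (I := I) γ (rightInvariantField X)) (s t : ℝ) : γ (s + t) = γ s * γ t := by
  have hv := (smooth_rightInvariantField X).contMDiff_one
  have h1 : IsMIntegralCurve (I := I) (fun s ↦ γ s * γ t) (rightInvariantField X) := fun s ↦ by
    have h3 : HasVelocityAt (E := E) I γ s (rightInvariantField X (γ s)) := hγ s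
    have h2 := h3.comp (mdifferentiableAt_of_smooth (smooth_mul_const (γ t))) rfl
    rw [tderiv_rightInvariantField] at h2
    exact h2
  exact congrFun (isMIntegralCurve_Ioo_eq_of_contMDiff_boundaryless (t₀ := 0) hv
    (hγ.comp_add t) h1 (by simp [h0])) s

theorem lieExp_smul (h0 : γ 0 = 1)
    (hγ : IsMIntegralCurve (I := I) γ (rightInvariantField X)) (t : ℝ) : lieExp (t • X) = γ t := by
  have hsmul : (rightInvariantField (t • X) : ∀ g : G, TangentSpace I g) =
      t • rightInvariantField X := by
    ext g
    exact map_smul (tderiv (E := E) I (fun x : G ↦ x * g) 1) t X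
  have h2 : IsMIntegralCurve (I := I) (γ ∘ (· * t)) (rightInvariantField (t • X)) := by
    rw [hsmul]; exact hγ.comp_mul t
  have hex : ∃ η : ℝ → G, η 0 = 1 ∧
      IsMIntegralCurve (I := I) η (rightInvariantField (t • X)) :=
    ⟨_, by simp [h0], h2⟩
  have hv := (smooth_rightInvariantField (t • X)).contMDiff_one
  have h3 := congrFun (isMIntegralCurve_Ioo_eq_of_contMDiff_boundaryless (t₀ := 0) hv
    hex.choose_spec.2 h2 (by rw [hex.choose_spec.1]; simp [h0])) 1
  rw [lieExp, dif_pos hex, h3]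
  simp

/-- By uniqueness of integral curves. Writing $\gamma(s) = \gamma(s-t)\gamma(t)$ reduces the
velocity at time $t$ to that of conjugation of $y = \gamma(t) g \gamma(t)^{-1}$ at the identity. -/
theorem flow_eq_conj (h0 : γ 0 = 1)
    (hγ : IsMIntegralCurve (I := I) γ (rightInvariantField X)) {V : ∀ g : G, TangentSpace I g} (hV : IsSmoothField I V)
    (hVX : ∀ g, V g = rightInvariantField X g + invPushforward (rightInvariantField X) g)
    {φ : ℝ → G → G} (hφ : IsFlowOf I φ V) (t : ℝ) (g : G) : φ t g = γ t * g * (γ t)⁻¹ := by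
  have h1 : IsMIntegralCurve (I := I) (fun t ↦ γ t * g * (γ t)⁻¹) V := fun t ↦ by
    set y := γ t * g * (γ t)⁻¹ with hy
    have h2 : HasVelocityAt (E := E) I (fun s ↦ γ (s - t)) t X := by
      have h3 := (hγ.comp_add (-t)) t
      have h5 : (rightInvariantField X (γ (t + -t)) : E) = X :=
        (congrArg (fun g ↦ (rightInvariantField X g : E)) (by rw [add_neg_cancel, h0])).trans
          (rightInvariantField_one X)
      exact (congrArg (HasVelocityAt (E := E) I (fun s ↦ γ (s - t)) t) h5).mp h3
    have h6 := h2.comp (mdifferentiableAt_of_smooth (smooth_conj_left (I := I) y)) (y := 1)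
      (by rw [sub_self, h0])
    have h7 : (fun s ↦ γ (s - t) * y * (γ (s - t))⁻¹) = fun s ↦ γ s * g * (γ s)⁻¹ := by
      ext s
      have h8 : γ s = γ (s - t) * γ t := by
        rw [← one_parameter_add h0 hγ, sub_add_cancel]
      rw [h8, hy]; group
    rw [h7] at h6
    exact (congrArg (HasVelocityAt (E := E) I (fun s ↦ γ s * g * (γ s)⁻¹) t)
      ((hVX y).trans (rightInvariantField_add_invPushforward X y)).symm).mp h6
  have hv := hV.contMDiff_one
  exact congrFun (isMIntegralCurve_Ioo_eq_of_contMDiff_boundaryless (t₀ := 0) hv (hφ g).2 h1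
    (by simp [h0, (hφ g).1])) t

theorem adjointRep_eq_exp [CompleteSpace E] (h0 : γ 0 = 1)
    (hγ : IsMIntegralCurve (I := I) γ (rightInvariantField X)) {B : E →L[ℝ] E →L[ℝ] E}
    (hB : HasFDerivAt (fun w ↦ adjointRep I ((extChartAt I (1 : G)).symm w)) B
      (extChartAt I (1 : G) 1)) (t : ℝ) :
    adjointRep I (γ t) = NormedSpace.exp (t • B X) := by
  have h1 : HasDerivAt (fun t ↦ extChartAt I (1 : G) (γ t)) (X : E) 0 := by
    have h2 : HasMFDerivAt I 𝓘(ℝ, E) (extChartAt I (1 : G)) (γ 0)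
        (ContinuousLinearMap.id ℝ E : E →L[ℝ] E) := by
      rw [h0]
      exact (congrArg (fun L : E →L[ℝ] E ↦ HasMFDerivAt I 𝓘(ℝ, E) (extChartAt I (1 : G)) 1 L)
        (chartDeriv_self (1 : G))).mp
        (mdifferentiableAt_extChartAt (mem_chart_source H (1 : G))).hasMFDerivAt
    have h3 : HasVelocityAt (E := E) I γ 0 X :=
      (congrArg (HasVelocityAt (E := E) I γ 0)
        ((congrArg (fun g ↦ (rightInvariantField X g : E)) h0).trans
          (rightInvariantField_one X))).mp (hγ 0)
    have h4 : HasMFDerivAt 𝓘(ℝ, ℝ) 𝓘(ℝ, E) (fun t ↦ extChartAt I (1 : G) (γ t)) 0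
        ((ContinuousLinearMap.id ℝ E).comp
          (ContinuousLinearMap.smulRight (1 : ℝ →L[ℝ] ℝ) (X : E)) : ℝ →L[ℝ] E) :=
      HasMFDerivAt.comp 0 h2 h3
    have h5 : HasFDerivAt (fun t ↦ extChartAt I (1 : G) (γ t))
        (ContinuousLinearMap.smulRight (1 : ℝ →L[ℝ] ℝ) (X : E) : ℝ →L[ℝ] E) 0 :=
      hasMFDerivAt_iff_hasFDerivAt.mp h4
    have h6 : ∀ x : E, (ContinuousLinearMap.smulRight (1 : ℝ →L[ℝ] ℝ) x) 1 = x := fun x ↦ by simp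
    exact (congrArg (fun x ↦ HasDerivAt (fun t ↦ extChartAt I (1 : G) (γ t)) x 0) (h6 X)).mp
      h5.hasDerivAt
  have hB0 : HasFDerivAt (fun w ↦ adjointRep I ((extChartAt I (1 : G)).symm w)) B
      (extChartAt I (1 : G) (γ 0)) := by
    rw [h0]; exact hB
  have h2 : HasDerivAt (fun t ↦ adjointRep I (γ t)) (B X) 0 := by
    refine (hB0.comp_hasDerivAt 0 h1).congr_of_eventuallyEq ?_
    have h3 : ∀ᶠ t in 𝓝 (0 : ℝ), γ t ∈ (extChartAt I (1 : G)).source :=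
      hγ.continuous.continuousAt.eventually_mem (by
        rw [h0]; exact extChartAt_source_mem_nhds (1 : G))
    filter_upwards [h3] with t ht
    exact congrArg _ ((extChartAt I (1 : G)).left_inv ht).symm
  exact eq_exp_of_hasDerivAt (a := fun t ↦ adjointRep I (γ t))
    (by rw [h0, adjointRep_one])
    (fun s t ↦ by rw [one_parameter_add h0 hγ, adjointRep_mul]) h2 t

theorem expFlow_eq_adjointRep [CompleteSpace E] [FiniteDimensional ℝ E] (h0 : γ 0 = 1)
    (hγ : IsMIntegralCurve (I := I) γ (rightInvariantField X)) {V : ∀ g : G, TangentSpace I g}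
    (hVX : ∀ g, V g = rightInvariantField X g + invPushforward (rightInvariantField X) g) (t : ℝ) :
    expFlow (derivationOf V) t = adjointRep I (γ t) := by
  obtain ⟨B, hB, -, hBV⟩ := exists_derivative_adjointRep (I := I) (G := G)
  have h3 := adjointRep_eq_exp h0 hγ hB.hasFDerivAt t
  let A : E →ₗ[ℝ] E := derivationOf V
  have h4 : B X = LinearMap.toContinuousLinearMap A :=
    ContinuousLinearMap.ext fun Y ↦ hBV X V hVX Y
  rw [h4] at h3
  exact h3.symm

end Curve
end LieGroups

/-! ### Baire category and a uniform period -/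

theorem exists_eq_top_of_isClosed_of_iUnion {G : Type*} [Group G] [TopologicalSpace G]
    [IsTopologicalGroup G] [ConnectedSpace G] [BaireSpace G] {ι : Type*} [Countable ι]
    (K : ι → Subgroup G) (hK : ∀ i, IsClosed (K i : Set G)) (hU : ∀ g, ∃ i, g ∈ K i) :
    ∃ i, K i = ⊤ := by
  obtain ⟨i, g, hg⟩ := nonempty_interior_of_iUnion_of_closed hK
    (eq_univ_of_forall fun g ↦ mem_iUnion.2 (hU g))
  have hopen : IsOpen (K i : Set G) :=
    (K i).isOpen_of_mem_nhds (mem_interior_iff_mem_nhds.1 hg)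
  refine ⟨i, SetLike.coe_injective ?_⟩
  exact IsClopen.eq_univ ⟨hK i, hopen⟩ ⟨1, (K i).one_mem⟩

section LieGroups

variable {E : Type*} [NormedAddCommGroup E] [NormedSpace ℝ E] {H : Type*} [TopologicalSpace H]
  {I : ModelWithCorners ℝ E H} {G : Type*} [TopologicalSpace G] [ChartedSpace H G] [Group G]
  [LieGroup I ∞ G]

/-- The elements of the group whose adjoint action commutes with a given operator. -/
def adjointCentralizer (I : ModelWithCorners ℝ E H) [LieGroup I ∞ G] (d : E →L[ℝ] E) :
    Subgroup G where
  carrier := {g | Commute d (adjointRep I g)}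
  one_mem' := by simp [adjointRep_one]
  mul_mem' {g h} hg hh := by
    simp only [mem_ofPred_eq, adjointRep_mul] at *
    exact hg.mul_right hh
  inv_mem' {g} hg := by
    have h1 : adjointRep I g * adjointRep I g⁻¹ = 1 := by
      rw [← adjointRep_mul, mul_inv_cancel, adjointRep_one]
    have h2 : adjointRep I g⁻¹ * adjointRep I g = 1 := by
      rw [← adjointRep_mul, inv_mul_cancel, adjointRep_one]
    change Commute d (adjointRep I g) at hg
    change d * adjointRep I g⁻¹ = adjointRep I g⁻¹ * d
    calc d * adjointRep I g⁻¹ = adjointRep I g⁻¹ * (adjointRep I g * d) * adjointRep I g⁻¹ := by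
          rw [← mul_assoc, h2, one_mul]
      _ = adjointRep I g⁻¹ * d := by rw [← hg.eq, mul_assoc, mul_assoc, h1, mul_one]

theorem isClosed_adjointCentralizer [CompleteSpace E] [I.Boundaryless] (d : E →L[ℝ] E) :
    IsClosed (adjointCentralizer (G := G) I d : Set G) :=
  isClosed_eq (continuous_const.mul continuous_adjointRep)
    (continuous_adjointRep.mul continuous_const)

/-- Differentiating the commutation at $e$ shows that $\mathrm{ad}\,X$ commutes with every
$\mathrm{ad}\,Y$. By Jacobi each $[X,Y]$ is central, hence zero, and so $X$ is central. -/
theorem eq_zero_of_adjointCentralizer_eq_top [CompleteSpace E] [I.Boundaryless]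
    (hc : ∀ Z : GroupLieAlgebra I G, (∀ Y : GroupLieAlgebra I G, ⁅Z, Y⁆ = 0) → Z = 0)
    {B : E →L[ℝ] E →L[ℝ] E}
    (hB : HasFDerivAt (fun w ↦ adjointRep I ((extChartAt I (1 : G)).symm w)) B
      (extChartAt I (1 : G) 1)) (hbr : ∀ Z Y : GroupLieAlgebra I G, B Z Y = ⁅Z, Y⁆)
    (X : GroupLieAlgebra I G) (hX : adjointCentralizer (G := G) I (B X) = ⊤) : X = 0 := by
  have h1 : ∀ g : G, B X * adjointRep I g = adjointRep I g * B X := fun g ↦ by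
    have : g ∈ adjointCentralizer (G := G) I (B X) := by rw [hX]; trivial
    exact this
  have h2 : ∀ Y : E, B X * B Y = B Y * B X := fun Y ↦ by
    have h3 := hB.const_mul (B X)
    have h4 := hB.mul_const' (B X)
    simp only [h1] at h3
    have h5 := congrArg (fun L : E →L[ℝ] E →L[ℝ] E ↦ L Y) (h3.unique h4)
    simpa using h5
  have h3 : ∀ Y Z : GroupLieAlgebra I G, ⁅X, ⁅Y, Z⁆⁆ = ⁅Y, ⁅X, Z⁆⁆ := fun Y Z ↦ by
    have h4 : B X (B Y Z) = B Y (B X Z) := congrArg (fun L : E →L[ℝ] E ↦ L Z) (h2 Y)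
    rw [hbr, hbr, hbr, hbr] at h4
    exact h4
  refine hc X fun Y ↦ hc _ fun Z ↦ ?_
  rw [lie_lie, h3, sub_self]

theorem exists_adjointRep_eq_one [FiniteDimensional ℝ E] [CompleteSpace E] [I.Boundaryless]
    [T2Space G] [CompactSpace G] [ConnectedSpace G]
    (hc : ∀ Z : GroupLieAlgebra I G, (∀ Y : GroupLieAlgebra I G, ⁅Z, Y⁆ = 0) → Z = 0)
    {X : GroupLieAlgebra I G} {γ : ℝ → G} (h0 : γ 0 = 1)
    (hγ : IsMIntegralCurve (I := I) γ (rightInvariantField X))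
    (hper : ∀ g : G, ∃ s > 0, Commute (γ s) g) : ∃ s > 0, adjointRep I (γ s) = 1 := by
  have : IsTopologicalGroup G := topologicalGroup_of_lieGroup I ∞
  obtain ⟨B, hB, hbr, -⟩ := exists_derivative_adjointRep (I := I) (G := G)
  have hexp := adjointRep_eq_exp h0 hγ hB.hasFDerivAt
  obtain ⟨S, hS, hSm⟩ := exists_countable_commute_exp (B X)
  let S' : Set ℝ := S ∩ Ioi 0
  have : Countable S' := (hS.mono inter_subset_left).to_subtype
  -- The index `none` collects all $g$ having a non-exceptional period; each exceptional positive
  -- period gets its own centralizer.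
  let K : Option S' → Subgroup G := fun i ↦
    i.elim (adjointCentralizer I (B X)) fun s ↦ Subgroup.centralizer {γ s}
  obtain ⟨i, hi⟩ := exists_eq_top_of_isClosed_of_iUnion K
    (by
      rintro (_ | s)
      · exact isClosed_adjointCentralizer _
      · exact Set.isClosed_centralizer _)
    (by
      intro g
      obtain ⟨s, hs, hsg⟩ := hper g
      by_cases hsS : s ∈ S
      · exact ⟨some ⟨s, hsS, hs⟩, Subgroup.mem_centralizer_singleton_iff.2 hsg.symm⟩
      · refine ⟨none, hSm s hsS _ ?_⟩
        rw [← hexp, Commute, SemiconjBy, ← adjointRep_mul, ← adjointRep_mul, hsg.eq])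
  rcases i with _ | s
  · have hX := eq_zero_of_adjointCentralizer_eq_top hc hB.hasFDerivAt hbr X hi
    refine ⟨1, one_pos, ?_⟩
    have hBX : B X = 0 := (congrArg B hX).trans (map_zero B)
    rw [hexp, hBX, smul_zero, NormedSpace.exp_zero]
  · refine ⟨s, s.2.2, ?_⟩
    have h1 : (fun x : G ↦ γ s * x * (γ s)⁻¹) = fun x ↦ x := by
      ext x
      have hx : x ∈ K (some s) := by rw [hi]; trivial
      have h2 : x * γ s = γ s * x := Subgroup.mem_centralizer_singleton_iff.1 hx
      rw [← h2, mul_inv_cancel_right]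
    rw [adjointRep, h1, tderiv_id]; rfl

end LieGroups

/-! ### Averaging a cocycle and the existence of $X$ -/

theorem exists_coboundary_of_cocycle {E : Type*} [NormedAddCommGroup E] [NormedSpace ℝ E]
    [FiniteDimensional ℝ E] {G : Type*} [Group G] [TopologicalSpace G] [IsTopologicalGroup G]
    [CompactSpace G] (ρ : G → E →L[ℝ] E) {c : G → E} (hc : Continuous c)
    (hcocycle : ∀ g h, c (g * h) = c g + ρ g (c h)) : ∃ X, ∀ g, c g = X - ρ g X := by
  have : CompleteSpace E := FiniteDimensional.complete ℝ E
  let : MeasurableSpace G := borel G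
  have : BorelSpace G := ⟨rfl⟩
  let μ : Measure G := Measure.haarMeasure ⊤
  have : IsProbabilityMeasure μ :=
    ⟨by simpa using Measure.haarMeasure_self (K₀ := (⊤ : TopologicalSpace.PositiveCompacts G))⟩
  have hint : ∀ f : G → E, Continuous f → Integrable f μ := fun f hf ↦
    hf.integrable_of_hasCompactSupport (HasCompactSupport.of_compactSpace f)
  -- Integrating the cocycle identity in $h$ and using left invariance gives $X = c(g) + \rho(g)X$.
  refine ⟨∫ h, c h ∂μ, fun g ↦ ?_⟩
  have h1 : ∫ h, c (g * h) ∂μ = ∫ h, c h ∂μ := integral_mul_left_eq_self c g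
  simp only [hcocycle] at h1
  rw [integral_add (integrable_const _) (hint (fun h ↦ ρ g (c h)) ((ρ g).continuous.comp hc)),
    (ρ g).integral_comp_comm (hint c hc), integral_const] at h1
  simp only [probReal_univ, one_smul] at h1
  rw [eq_sub_iff_add_eq, h1]

section LieGroups

variable {E : Type*} [NormedAddCommGroup E] [NormedSpace ℝ E] {H : Type*} [TopologicalSpace H]
  {I : ModelWithCorners ℝ E H} {G : Type*} [TopologicalSpace G] [ChartedSpace H G] [Group G]
  [LieGroup I ∞ G]

/-- A vector field translated to the identity by right multiplications. -/
noncomputable def rightTranslate (V : ∀ g : G, TangentSpace I g) (g : G) : E :=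
  tderiv I (fun x ↦ x * g⁻¹) g (V g)

theorem continuous_rightTranslate {V : ∀ g : G, TangentSpace I g} (hV : IsSmoothField I V) :
    Continuous (rightTranslate V : G → E) := by
  let F₁ : G → TangentBundle I G × TangentBundle I G :=
    fun g ↦ (⟨g, V g⟩, ⟨g⁻¹, (0 : TangentSpace I g⁻¹)⟩)
  have S₁ : ContMDiff I (I.tangent.prod I.tangent) ∞ F₁ :=
    ContMDiff.prodMk hV ((Bundle.contMDiff_zeroSection ℝ _).comp smooth_inv)
  have S₂ : Continuous (fun g ↦ (⟨(1 : G), rightTranslate (E := E) V g⟩ : TangentBundle I G)) := by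
    refine (smooth_tangentMap_mul.comp S₁).continuous.congr fun g ↦ ?_
    have hL : ∀ (L : E →L[ℝ] E) (v : E), v + L 0 = v := fun L v ↦ by simp
    exact totalSpace_mk_congr (mul_inv_cancel g) (hL _ _)
  -- All the vectors lie in the fibre over $e$, where this trivialization is the identity, so
  -- continuity passes from the bundle to `E`.
  let e := trivializationAt E (TangentSpace I) (1 : G)
  have h1 : Continuous fun g ↦ (e ⟨(1 : G), rightTranslate (E := E) V g⟩).2 := by
    refine continuous_snd.comp (e.continuousOn.comp_continuous S₂ fun g ↦ ?_)
    rw [e.mem_source]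
    exact mem_chart_source H (1 : G)
  refine h1.congr fun g ↦ ?_
  simp only [e, TangentBundle.trivializationAt_apply]
  exact congrArg (fun L : E →L[ℝ] E ↦ L (rightTranslate V g))
    (fderivWithin_extChartAt_comp_extChartAt_symm_range (I := I) (x := (1 : G)))

/-- Differentiate $\varphi_t(gh) = \varphi_t(g)\varphi_t(h)$ at $t = 0$. -/
theorem IsLinearVectorField.apply_mul {V : ∀ g : G, TangentSpace I g}
    (hV : IsLinearVectorField I V) (g h : G) :
    (V (g * h) : E) = tderiv I (fun y ↦ y * h) g (V g) + tderiv I (fun y ↦ g * y) h (V h) := by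
  obtain ⟨-, φ, hφ, haut⟩ := hV
  have hvel : ∀ g, HasVelocityAt (E := E) I (fun t ↦ φ t g) 0 (V g) := fun g ↦
    (congrArg (HasVelocityAt (E := E) I (fun t ↦ φ t g) 0)
      (congrArg (fun x ↦ (V x : E)) (hφ g).1)).mp ((hφ g).2 0)
  have hmul : (fun t ↦ φ t g * φ t h) = fun t ↦ φ t (g * h) := by
    ext t
    obtain ⟨e, he, -⟩ := haut t
    rw [← he, ← he, ← he, map_mul]
  have h1 := (hvel g).mul (hvel h)
  rw [hmul, (hφ g).1, (hφ h).1] at h1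
  exact (hvel (g * h)).unique h1

theorem rightTranslate_mul {V : ∀ g : G, TangentSpace I g} (hV : IsLinearVectorField I V)
    (g h : G) :
    (rightTranslate V (g * h) : E) =
      rightTranslate V g + adjointRep I g (rightTranslate V h) := by
  have e₁ : ∀ v : E, tderiv I (fun x ↦ x * (g * h)⁻¹) (g * h) (tderiv I (fun y ↦ y * h) g v) =
      tderiv I (fun x ↦ x * g⁻¹) g v := fun v ↦ by
    rw [← tderiv_comp_apply (mdifferentiableAt_of_smooth (smooth_mul_const _))
      (mdifferentiableAt_of_smooth (smooth_mul_const h)) rfl]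
    congr 2
    ext x; group
  have e₂ : ∀ v : E, tderiv I (fun x ↦ x * (g * h)⁻¹) (g * h) (tderiv I (fun y ↦ g * y) h v) =
      adjointRep I g (tderiv I (fun x ↦ x * h⁻¹) h v) := fun v ↦ by
    rw [adjointRep, ← tderiv_comp_apply (mdifferentiableAt_of_smooth (smooth_mul_const _))
      (mdifferentiableAt_of_smooth (smooth_const_mul g)) rfl,
      ← tderiv_comp_apply (mdifferentiableAt_of_smooth (smooth_conj g))
      (mdifferentiableAt_of_smooth (smooth_mul_const _)) (mul_inv_cancel h)]
    congr 2
    ext x; group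
  exact (congrArg (tderiv (E := E) I (fun x ↦ x * (g * h)⁻¹) (g * h)) (hV.apply_mul g h)).trans
    ((map_add (tderiv (E := E) I (fun x ↦ x * (g * h)⁻¹) (g * h)) _ _).trans
      (congrArg₂ (· + ·) (e₁ _) (e₂ _)))

theorem exists_rightInvariantField_add_invPushforward [FiniteDimensional ℝ E] [CompactSpace G]
    {V : ∀ g : G, TangentSpace I g} (hV : IsLinearVectorField I V) :
    ∃ X : GroupLieAlgebra I G, ∀ g : G,
      V g = rightInvariantField X g + invPushforward (rightInvariantField X) g := by
  have : IsTopologicalGroup G := topologicalGroup_of_lieGroup I ∞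
  obtain ⟨X, hX⟩ := exists_coboundary_of_cocycle (E := E) (adjointRep I)
    (continuous_rightTranslate hV.1) (rightTranslate_mul hV)
  refine ⟨X, fun g ↦ ?_⟩
  refine Eq.trans ?_ (rightInvariantField_add_invPushforward X g).symm
  have h1 : ∀ v : E, tderiv I (fun x ↦ x * g) 1 (tderiv I (fun x ↦ x * g⁻¹) g v) = v := fun v ↦ by
    rw [← tderiv_comp_apply (mdifferentiableAt_of_smooth (smooth_mul_const g))
      (mdifferentiableAt_of_smooth (smooth_mul_const _)) (mul_inv_cancel g)]
    simp only [inv_mul_cancel_right]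
    rw [tderiv_id]; rfl
  have h2 : tderiv I (fun x ↦ x * g) 1 (adjointRep I g X) = tderiv I (fun x ↦ g * x) 1 X := by
    rw [adjointRep, ← tderiv_comp_apply (mdifferentiableAt_of_smooth (smooth_mul_const g))
      (mdifferentiableAt_of_smooth (smooth_conj _)) (by simp)]
    simp only [inv_mul_cancel_right]
  have h3 := congrArg (tderiv (E := E) I (fun x ↦ x * g) 1) (hX g)
  rw [map_sub, h2, ← tderiv_conj_left] at h3
  exact (h1 (V g)).symm.trans h3

theorem eq_zero_of_forall_lie_eq_zero {L : Type*} [LieRing L] [LieAlgebra ℝ L]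
    [LieAlgebra.IsSemisimple ℝ L] (Z : L) (hZ : ∀ Y : L, ⁅Z, Y⁆ = 0) : Z = 0 := by
  have h1 : Z ∈ LieAlgebra.center ℝ L := by
    refine (LieModule.mem_maxTrivSubmodule ℝ _ _ _).2 fun Y ↦ ?_
    rw [← lie_skew, hZ, neg_zero]
  rw [LieAlgebra.center_eq_bot] at h1
  exact (LieSubmodule.mem_bot _).1 h1

end LieGroups

end LinearFlow

/-! ### The equivalences -/

theorem mainTheorem10
    {E : Type*} [NormedAddCommGroup E] [NormedSpace ℝ E] [FiniteDimensional ℝ E] [CompleteSpace E]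
    {H : Type*} [TopologicalSpace H] (I : ModelWithCorners ℝ E H) [I.Boundaryless]
    (G : Type*) [TopologicalSpace G] [ChartedSpace H G] [Group G] [LieGroup I ∞ G]
    [T2Space G] [ConnectedSpace G] [CompactSpace G]
    [LieAlgebra.IsSemisimple ℝ (GroupLieAlgebra I G)]
    (𝒳 : ∀ g : G, TangentSpace I g) (h𝒳 : LinearFlow.IsLinearVectorField I 𝒳)
    (φ : ℝ → G → G) (hφ : LinearFlow.IsFlowOf I φ 𝒳) :
    (∃ X : GroupLieAlgebra I G, ∀ g : G,
      𝒳 g = LinearFlow.rightInvariantField X g +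
        LinearFlow.invPushforward (LinearFlow.rightInvariantField X) g) ∧
    ∀ X : GroupLieAlgebra I G,
      (∀ g : G, 𝒳 g = LinearFlow.rightInvariantField X g +
        LinearFlow.invPushforward (LinearFlow.rightInvariantField X) g) →
      List.TFAE [
        ∀ g : G, LinearFlow.IsPeriodicCurve (fun t : ℝ ↦ LinearFlow.lieExp (t • X) * g),
        LinearFlow.IsPeriodicCurve (fun t : ℝ ↦ LinearFlow.lieExp (t • X) * (1 : G)),
        ∀ g : G, LinearFlow.IsPeriodicCurve (fun t : ℝ ↦ φ t g),
        ∀ g : G, LinearFlow.IsPeriodicCurve (fun t : ℝ ↦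
          (LinearFlow.expFlow (LinearFlow.derivationOf 𝒳) t).comp (LinearFlow.Ad g))] := by
  refine ⟨LinearFlow.exists_rightInvariantField_add_invPushforward h𝒳, fun X hX ↦ ?_⟩
  obtain ⟨γ, h0, hγ⟩ := LinearFlow.exists_one_parameter_curve X
  have hadd := LinearFlow.one_parameter_add h0 hγ
  have hflow := LinearFlow.flow_eq_conj h0 hγ h𝒳.1 hX hφ
  have hAd := LinearFlow.expFlow_eq_adjointRep h0 hγ hX
  have hc : ∀ Z : GroupLieAlgebra I G, (∀ Y : GroupLieAlgebra I G, ⁅Z, Y⁆ = 0) → Z = 0 :=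
    LinearFlow.eq_zero_of_forall_lie_eq_zero
  simp only [LinearFlow.lieExp_smul h0 hγ, hflow]
  tfae_have 1 → 2 := fun h ↦ h 1
  tfae_have 2 → 1 := by
    rintro ⟨s, hs, h⟩ g
    refine ⟨s, hs, fun t ↦ ?_⟩
    have h1 := h t
    simp only [mul_one] at h1
    simp only [h1]
  tfae_have 2 → 3 := by
    rintro ⟨s, hs, h⟩ g
    refine ⟨s, hs, fun t ↦ ?_⟩
    have h1 := h t
    simp only [mul_one] at h1
    simp only [h1]
  tfae_have 3 → 4 := by
    intro h g
    -- This period no longer depends on $g$; periodicity at $t = 0$ says that $\gamma(s)$ commutes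
    -- with $g$.
    obtain ⟨s, hs, hs1⟩ := LinearFlow.exists_adjointRep_eq_one hc h0 hγ fun g ↦ by
      obtain ⟨s, hs, h⟩ := h g
      refine ⟨s, hs, ?_⟩
      have h1 := h 0
      simp only [zero_add, h0, one_mul, inv_one, mul_one] at h1
      exact mul_inv_eq_iff_eq_mul.1 h1
    refine ⟨s, hs, fun t ↦ ?_⟩
    have h1 : LinearFlow.expFlow (LinearFlow.derivationOf 𝒳) (t + s) =
        LinearFlow.expFlow (LinearFlow.derivationOf 𝒳) t := by
      refine (hAd _).trans (Eq.trans ?_ (hAd t).symm)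
      rw [hadd, LinearFlow.adjointRep_mul, hs1, mul_one]
    simp only [h1]
  tfae_have 4 → 2 := by
    intro h
    obtain ⟨s, hs, h⟩ := h 1
    have hAd1 : LinearFlow.Ad (1 : G) = (1 : E →L[ℝ] E) := LinearFlow.adjointRep_one (I := I)
    have h1 : LinearFlow.adjointRep I (γ s) = 1 := by
      have hcancel : ∀ P Q A : E →L[ℝ] E, A = 1 → P.comp A = Q.comp A → P = Q := by
        rintro P Q _ rfl hPQ
        exact hPQ
      have h2 := (hAd (0 + s)).symm.trans ((hcancel _ _ _ hAd1 (h 0)).trans (hAd 0))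
      rwa [zero_add, h0, LinearFlow.adjointRep_one] at h2
    have := LinearFlow.finite_ker_adjointHom (I := I) (G := G) hc
    -- The period $s$ of $\mathrm{Ad}\circ\gamma$ need not be one of $\gamma$, but a multiple $ns$
    -- is.
    obtain ⟨n, hn, hpow⟩ := (isOfFinOrder_of_finite
      (⟨γ s, MonoidHom.mem_ker.2 h1⟩ : (LinearFlow.adjointHom (G := G) I).ker)).exists_pow_eq_one
    have hpow' : γ s ^ n = 1 := congrArg Subtype.val hpow
    have hns : ∀ n : ℕ, γ (n * s) = γ s ^ n := fun n ↦ by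
      induction n with
      | zero => simp [h0]
      | succ n ih => rw [Nat.cast_succ, add_mul, one_mul, hadd, ih, pow_succ]
    refine ⟨n * s, by positivity, fun t ↦ ?_⟩
    simp only [hadd, hns, hpow', mul_one]
  tfae_finish
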